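/- Let $U\subset\mathbb R^3$ be open and connected and let $f:U\to\mathbb R^3$ be smooth. Suppose that the system of conservation laws $u_t=f(u)_x$ is strictly hyperbolic on $U$: its matrix $v=(\partial f^i/\partial u^j)$ has real, pairwise distinct (smooth) eigenvalues $\lambda^1,\lambda^2,\lambda^3$. Suppose it is a T-system: for each $i$, every rarefaction curve of the $i$-th family (a curve in $U$ whose velocity is everywhere a nonzero right eigenvector of $v$ for $\lambda^i$) is contained in a straight line, and $\lambda^i$ is constant along it. Suppose finally that it has no Riemann invariants: for no $i$ and no nonempty open $V\subset U$ is there a smooth function $R$ on $V$ with $dR\neq0$ everywhere and $dR\circ v=\lambda^i\,dR$. Let $\tilde\omega^i$ be smooth eigenforms on $U$, i.e. nowhere vanishing smooth one-forms with $\tilde\omega^i\circ v=\lambda^i\tilde\omega^i$ $(i=1,2,3)$. 1. After a suitable renumbering of the eigenvalues, and of the eigenforms accordingly, there are smooth nowhere vanishing functions $\rho^i$ on $U$ and a constant $\epsilon=\pm1$ such that the forms $\omega^i=\rho^i\tilde\omega^i$ satisfy on $U$ $$d\omega^1=\omega^2\wedge\omega^3,\qquad d\omega^2=\epsilon\,\omega^3\wedge\omega^1,\qquad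 d\omega^3=\omega^1\wedge\omega^2.$$ 2. Whenever, for some numbering, the forms $\omega^i=\rho^i\tilde\omega^i$ (with $\rho^i$ smooth and nowhere vanishing) and a constant $\epsilon=\pm1$ satisfy on $U$ $$\begin{aligned}d\omega^1&=a\,\omega^1\wedge\omega^2+b\,\omega^1\wedge\omega^3+\omega^2\wedge\omega^3,\\ d\omega^2&=p\,\omega^2\wedge\omega^1+q\,\omega^2\wedge\omega^3+\epsilon\,\omega^3\wedge\omega^1,\\ d\omega^3&=r\,\omega^3\wedge\omega^1+s\,\omega^3\wedge\omega^2+\omega^1\wedge\omega^2\end{aligned}$$ with functions $a,b,p,q,r,s$, one has $a=b=p=q=r=s=0$ on $U$, and all second derivatives of the eigenvalues are expressed through the eigenvalues and their first derivatives as follows. Write $d\lambda^i=\sum_j\lambda^i_j\,\omega^j$, $d\lambda^i_j=\sum_k\lambda^i_{jk}\,\omega^k$ and $(\epsilon_1,\epsilon_2,\epsilon_3)=(1,\epsilon,1)$. Then $\lambda^i_i=0$ and $\lambda^i_{ij}=0$ for all $i,j$; for every cyclic permutation $(i,j,k)$ of $(1,2,3)$ $$\lambda^i_{ji}=-\epsilon_k\lambda^i_k,\qquad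 \lambda^i_{ki}=\epsilon_j\lambda^i_j,$$ $$\begin{aligned}\lambda^i_{jk}=\lambda^i_{kj}={}&\lambda^i_j\lambda^i_k\Big(\tfrac1{\lambda^i-\lambda^j}+\tfrac1{\lambda^i-\lambda^k}\Big)+\lambda^i_k\lambda^k_j\Big(\tfrac1{\lambda^j-\lambda^k}+\tfrac1{\lambda^k-\lambda^i}\Big)-\lambda^i_j\lambda^j_k\Big(\tfrac1{\lambda^i-\lambda^j}+\tfrac1{\lambda^j-\lambda^k}\Big)\\&+\epsilon_i\Big(\lambda^k_i\Big(\tfrac{\lambda^j-\lambda^i}{\lambda^j-\lambda^k}\Big)^2-\lambda^j_i\Big(\tfrac{\lambda^k-\lambda^i}{\lambda^k-\lambda^j}\Big)^2\Big);\end{aligned}$$ and for all pairwise distinct $i,j,k$ $$\lambda^i_{jj}=-2\lambda^i_j\lambda^k_j\Big(\tfrac1{\lambda^i-\lambda^k}+\tfrac1{\lambda^k-\lambda^j}\Big)+\frac{2(\lambda^i_j)^2}{\lambda^i-\lambda^k}+2\epsilon_i\epsilon_k\frac{(\lambda^i-\lambda^k)(\lambda^i-\lambda^j)}{\lambda^k-\lambda^j}.$$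 -/

import Mathlib

open scoped ContDiff

/-! ### Systems of conservation laws

A system `u_t = f(u)_x` of `n` conservation laws is given by its flux `f`, a smooth map from an
open set `U` of `ℝⁿ` to `ℝⁿ`. Its characteristic matrix at `u` is the Jacobian `fderiv ℝ f u`. -/

/-- The system `u_t = f(u)_x` with smooth flux on `U` is strictly hyperbolic, with (smooth)
eigenvalues `lam 0, …, lam (n - 1)` that are real and pairwise distinct at each point. -/
structure IsStrictlyHyperbolic {n : ℕ} (U : Set (Fin n → ℝ)) (f : (Fin n → ℝ) → (Fin n → ℝ))
    (lam : Fin n → (Fin n → ℝ) → ℝ) : Prop where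
  smooth_flux : ContDiffOn ℝ ∞ f U
  smooth_eigenvalue : ∀ i, ContDiffOn ℝ ∞ (lam i) U
  eigenvalue : ∀ u ∈ U, ∀ i,
    Module.End.HasEigenvalue (fderiv ℝ f u : Module.End ℝ (Fin n → ℝ)) (lam i u)
  distinct : ∀ u ∈ U, ∀ i j, i ≠ j → lam i u ≠ lam j u

/-- A rarefaction curve of the family of the eigenvalue `mu`, parametrized over the open interval
`(s, t)`: a curve in `U` whose velocity at each time is an eigenvector (in particular nonzero) of
the characteristic matrix for the eigenvalue `mu`. -/
def IsRarefactionCurve {n : ℕ} (U : Set (Fin n → ℝ)) (f : (Fin n → ℝ) → (Fin n → ℝ))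
    (mu : (Fin n → ℝ) → ℝ) (s t : ℝ) (γ : ℝ → (Fin n → ℝ)) : Prop :=
  ∀ τ ∈ Set.Ioo s t, γ τ ∈ U ∧ ∃ ξ : Fin n → ℝ,
    Module.End.HasEigenvector (fderiv ℝ f (γ τ) : Module.End ℝ (Fin n → ℝ)) (mu (γ τ)) ξ ∧
      HasDerivAt γ ξ τ

/-- A T-system: a strictly hyperbolic system such that, for each family, (a) the rarefaction
curves are straight lines in the coordinates `u`, and (b) the eigenvalue is constant along the
rarefaction curves of its own family (linear degeneracy). -/
structure IsTSystem {n : ℕ} (U : Set (Fin n → ℝ)) (f : (Fin n → ℝ) → (Fin n → ℝ))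
    (lam : Fin n → (Fin n → ℝ) → ℝ) : Prop extends IsStrictlyHyperbolic U f lam where
  straight : ∀ i s t γ, IsRarefactionCurve U f (lam i) s t γ →
    Collinear ℝ (γ '' Set.Ioo s t)
  linearly_degenerate : ∀ i s t γ, IsRarefactionCurve U f (lam i) s t γ →
    ∀ τ ∈ Set.Ioo s t, ∀ τ' ∈ Set.Ioo s t, lam i (γ τ) = lam i (γ τ')

/-- `R` is a Riemann invariant on `V` for the eigenvalue `mu`: a smooth function without critical
points such that `R_t = mu R_x` by virtue of `u_t = f(u)_x`, i.e. `dR ∘ f' = mu dR`. -/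
def IsRiemannInvariant {n : ℕ} (V : Set (Fin n → ℝ)) (f : (Fin n → ℝ) → (Fin n → ℝ))
    (mu : (Fin n → ℝ) → ℝ) (R : (Fin n → ℝ) → ℝ) : Prop :=
  ContDiffOn ℝ ∞ R V ∧ ∀ u ∈ V, fderiv ℝ R u ≠ 0 ∧
    (fderiv ℝ R u).comp (fderiv ℝ f u) = mu u • fderiv ℝ R u

/-- The system has no Riemann invariants, not even local ones: no eigenvalue possesses a Riemann
invariant on any nonempty open part of `U`. -/
def HasNoRiemannInvariants {n : ℕ} (U : Set (Fin n → ℝ)) (f : (Fin n → ℝ) → (Fin n → ℝ))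
    (lam : Fin n → (Fin n → ℝ) → ℝ) : Prop :=
  ∀ i, ∀ V ⊆ U, IsOpen V → V.Nonempty → ¬ ∃ R, IsRiemannInvariant V f (lam i) R

/-- `om 0, …, om (n - 1)` are eigenforms on `U`: smooth one-forms whose coefficient vectors are
(nonzero) left eigenvectors of the characteristic matrix for `lam 0, …, lam (n - 1)`. -/
def IsEigenforms {n : ℕ} (U : Set (Fin n → ℝ)) (f : (Fin n → ℝ) → (Fin n → ℝ))
    (lam : Fin n → (Fin n → ℝ) → ℝ) (om : Fin n → (Fin n → ℝ) → ((Fin n → ℝ) →L[ℝ] ℝ)) : Prop :=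
  ∀ i, ContDiffOn ℝ ∞ (om i) U ∧ ∀ u ∈ U, om i u ≠ 0 ∧
    (om i u).comp (fderiv ℝ f u) = lam i u • om i u

/-! ### Exterior calculus of one-forms -/

/-- The exterior derivative of the one-form `α` at `u`, evaluated on the vectors `v`, `w`. -/
noncomputable def dForm {n : ℕ} (α : (Fin n → ℝ) → ((Fin n → ℝ) →L[ℝ] ℝ))
    (u v w : Fin n → ℝ) : ℝ :=
  extDeriv (fun x => ContinuousAlternatingMap.ofSubsingleton ℝ (Fin n → ℝ) ℝ (0 : Fin 1) (α x)) u
    ![v, w]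

/-- The usual formula `dα(v, w) = (D_v α)(w) - (D_w α)(v)`. -/
theorem dForm_eq {n : ℕ} {α : (Fin n → ℝ) → ((Fin n → ℝ) →L[ℝ] ℝ)} {u : Fin n → ℝ}
    (h : DifferentiableAt ℝ α u) (v w : Fin n → ℝ) :
    dForm α u v w = fderiv ℝ α u v w - fderiv ℝ α u w v := by
  have h' : DifferentiableAt ℝ (fun x => ContinuousAlternatingMap.ofSubsingleton ℝ (Fin n → ℝ) ℝ
      (0 : Fin 1) (α x)) u :=
    ((ContinuousAlternatingMap.ofSubsingletonLIE (𝕜 := ℝ) (E := Fin n → ℝ) (F := ℝ) (0 : Fin 1)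
      ).toContinuousLinearEquiv.differentiableAt).comp u h
  have key : ∀ x y : Fin n → ℝ, fderiv ℝ (fun z => α z x) u y = fderiv ℝ α u y x := by
    intro x y
    rw [fderiv_clm_apply h (differentiableAt_const x)]
    simp
  rw [dForm, extDeriv_apply h']
  simp [Fin.sum_univ_two, Fin.removeNth, key, sub_eq_add_neg]

/-- The wedge product of two covectors, evaluated on the vectors `v`, `w`. -/
def wedge {n : ℕ} (α β : (Fin n → ℝ) →L[ℝ] ℝ) (v w : Fin n → ℝ) : ℝ :=
  α v * β w - α w * β v

/-- `p` is an admissible change of normalization on `U`: smooth nowhere vanishing factors. -/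
def IsNormalization {n : ℕ} (U : Set (Fin n → ℝ)) (p : Fin n → (Fin n → ℝ) → ℝ) : Prop :=
  ∀ i, ContDiffOn ℝ ∞ (p i) U ∧ ∀ u ∈ U, p i u ≠ 0

/-- The forms `p i • om (σ i)`: the eigenforms `om`, renumbered by `σ` and renormalized by `p`. -/
def renormalize {n : ℕ} (om : Fin n → (Fin n → ℝ) → ((Fin n → ℝ) →L[ℝ] ℝ))
    (σ : Equiv.Perm (Fin n)) (p : Fin n → (Fin n → ℝ) → ℝ) :
    Fin n → (Fin n → ℝ) → ((Fin n → ℝ) →L[ℝ] ℝ) :=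
  fun i u => p i u • om (σ i) u

/-! ### Structure equations in three components

The forms `ω^1, ω^2, ω^3` are `Ω 0, Ω 1, Ω 2`. -/

/-- The structure equations
`dω^1 = ω^2 ∧ ω^3`, `dω^2 = ε ω^3 ∧ ω^1`, `dω^3 = ω^1 ∧ ω^2` on `U`. -/
def StructureEquations (U : Set (Fin 3 → ℝ)) (ε : ℝ)
    (Ω : Fin 3 → (Fin 3 → ℝ) → ((Fin 3 → ℝ) →L[ℝ] ℝ)) : Prop :=
  ∀ u ∈ U, ∀ v w,
    dForm (Ω 0) u v w = wedge (Ω 1 u) (Ω 2 u) v w ∧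
    dForm (Ω 1) u v w = ε * wedge (Ω 2 u) (Ω 0 u) v w ∧
    dForm (Ω 2) u v w = wedge (Ω 0 u) (Ω 1 u) v w

/-- The structure equations with remaining coefficients `a, b, p, q, r, s`:
`dω^1 = a ω^1 ∧ ω^2 + b ω^1 ∧ ω^3 + ω^2 ∧ ω^3`,
`dω^2 = p ω^2 ∧ ω^1 + q ω^2 ∧ ω^3 + ε ω^3 ∧ ω^1`,
`dω^3 = r ω^3 ∧ ω^1 + s ω^3 ∧ ω^2 + ω^1 ∧ ω^2` on `U`. -/
def StructureEquationsWith (U : Set (Fin 3 → ℝ)) (ε : ℝ) (a b p q r s : (Fin 3 → ℝ) → ℝ)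
    (Ω : Fin 3 → (Fin 3 → ℝ) → ((Fin 3 → ℝ) →L[ℝ] ℝ)) : Prop :=
  ∀ u ∈ U, ∀ v w,
    dForm (Ω 0) u v w = a u * wedge (Ω 0 u) (Ω 1 u) v w + b u * wedge (Ω 0 u) (Ω 2 u) v w +
      wedge (Ω 1 u) (Ω 2 u) v w ∧
    dForm (Ω 1) u v w = p u * wedge (Ω 1 u) (Ω 0 u) v w + q u * wedge (Ω 1 u) (Ω 2 u) v w +
      ε * wedge (Ω 2 u) (Ω 0 u) v w ∧
    dForm (Ω 2) u v w = r u * wedge (Ω 2 u) (Ω 0 u) v w + s u * wedge (Ω 2 u) (Ω 1 u) v w +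
      wedge (Ω 0 u) (Ω 1 u) v w

/-- `g j` are the derivatives of the function `h` with respect to the coframe `Ω` on `U`:
`dh = ∑ j, g j ω^j`. -/
def IsCoframeDeriv (U : Set (Fin 3 → ℝ)) (Ω : Fin 3 → (Fin 3 → ℝ) → ((Fin 3 → ℝ) →L[ℝ] ℝ))
    (h : (Fin 3 → ℝ) → ℝ) (g : Fin 3 → (Fin 3 → ℝ) → ℝ) : Prop :=
  ∀ u ∈ U, HasFDerivAt h (∑ j, g j u • Ω j u) u

/-- The expressions of all second coframe derivatives of the eigenvalues `x i` (at one point)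
through the eigenvalues and their first coframe derivatives. Here `l i j` is the `j`-th derivative
of the `i`-th eigenvalue, `m i j k` is the `k`-th derivative of `l i j`, and `e i` are the
coefficients in `dω^i = e i ω^{i+1} ∧ ω^{i+2}` (indices modulo 3). -/
structure SecondDerivativeFormulas (e x : Fin 3 → ℝ) (l : Fin 3 → Fin 3 → ℝ)
    (m : Fin 3 → Fin 3 → Fin 3 → ℝ) : Prop where
  /-- `λ^i_i = 0`. -/
  diag : ∀ i, l i i = 0
  /-- `λ^i_{ij} = 0`. -/
  diag_deriv : ∀ i j, m i i j = 0
  /-- `λ^i_{ji}` for `j = i + 1`. -/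
  mixed_succ : ∀ i, m i (i + 1) i = -(e (i + 2) * l i (i + 2))
  /-- `λ^i_{ji}` for `j = i + 2`. -/
  mixed_pred : ∀ i, m i (i + 2) i = e (i + 1) * l i (i + 1)
  /-- `λ^i_{jk}` and `λ^i_{kj}` for cyclic `(j, k, i)`. -/
  off : ∀ i j k, j = i + 1 → k = i + 2 →
    m i j k = l i j * l i k * (1 / (x i - x j) + 1 / (x i - x k))
      + l i k * l k j * (1 / (x j - x k) + 1 / (x k - x i))
      - l i j * l j k * (1 / (x i - x j) + 1 / (x j - x k))
      + e i * (l k i * ((x j - x i) / (x j - x k)) ^ 2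
        - l j i * ((x k - x i) / (x k - x j)) ^ 2) ∧
    m i k j = m i j k
  /-- `λ^i_{jj}` for pairwise distinct `i, j, k`. -/
  second : ∀ i j k, i ≠ j → j ≠ k → k ≠ i →
    m i j j = -2 * l i j * l k j * (1 / (x i - x k) + 1 / (x k - x j))
      + 2 * l i j ^ 2 / (x i - x k)
      + 2 * (e i * e k) * ((x i - x k) * (x i - x j) / (x k - x j))

/-! The eigenforms `Ω` of the system have a dual frame `X` of right eigenvectors, and the flat
connection `∇` of `ℝ³` is described by its Christoffel symbols `Γ^k_{ij}` in this frame. Since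
`f' = df` is closed, `∇f'` is symmetric; this expresses `Γ^k_{ij}` for distinct indices through the
structure coefficient `c^k_{ij}`, and `Γ^j_{ji}` through `X_i(λ^j)`. The rarefaction curves are
straight exactly when `Γ^k_{ii} = 0` for `k ≠ i`. Everything else follows from the vanishing of the
curvature of `∇`.

For a coframe in which the `c^k_{ij}` with distinct indices are nonzero constants, the components of
the curvature first give `Γ^i_{ii}` and `c^j_{ij} = c^k_{ik}` (`IsConstTFrame.christoffel_diag`,
`IsConstTFrame.structCoeff_trace`), next the vanishing of this trace part
(`IsConstTFrame.structCoeff_trace_eq_zero`), and finally all second derivatives of the eigenvalues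
(`IsConstTFrame.secondDerivativeFormulas`). This is the second part of the theorem.

For the first part it has to be shown that `c^k_{ij}` has no zeros; then the factors
`ρ k = ± |c^i_{jk} c^j_{ki}|^{1/2}` normalize the coframe. If `c^k_{ij}` vanishes on an open set,
then the planes `ker Ω k` are autoparallel there, their integral surfaces are planes, and a Riemann
invariant can be written down explicitly (`IsTFrame.exists_riemannInvariant`). Hence the set where
all three coefficients are nonzero is dense. On it, the vanishing of the trace part for the
normalized coframe, rewritten for the given one, becomes an equation `dc = c B` for `c = c^k_{ij}`,
with a one-form `B` that is continuous on all of `U` (`IsTFrame.fderiv_structCoeff_of_ne_zero`). By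
density the equation holds on `U`, so a zero of `c` would propagate to all of the connected set `U`,
by Gronwall's inequality (`eq_zero_of_fderiv_eq_smul`), and produce a Riemann invariant. -/

/-! ### Frames and the flat connection -/

/-- The derivative `X_i(g)` of `g` along the `i`-th vector field of the frame `X`. -/
noncomputable def frameDeriv {F : Type*} [NormedAddCommGroup F] [NormedSpace ℝ F]
    (X : Fin 3 → (Fin 3 → ℝ) → (Fin 3 → ℝ)) (i : Fin 3) (g : (Fin 3 → ℝ) → F)
    (u : Fin 3 → ℝ) : F :=
  fderiv ℝ g u (X i u)

/-- The Christoffel symbol `Γ^k_{ij} = ω^k(∇_{X_i} X_j)` of the flat connection of `ℝ³` with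
respect to the frame `X` with dual coframe `Ω`. -/
noncomputable def christoffel (Ω : Fin 3 → (Fin 3 → ℝ) → ((Fin 3 → ℝ) →L[ℝ] ℝ))
    (X : Fin 3 → (Fin 3 → ℝ) → (Fin 3 → ℝ)) (k i j : Fin 3) (u : Fin 3 → ℝ) : ℝ :=
  Ω k u (frameDeriv X i (X j) u)

/-- The coefficient `c^k_{ij} = ω^k([X_i, X_j])` of the commutator of two fields of the frame. -/
noncomputable def structCoeff (Ω : Fin 3 → (Fin 3 → ℝ) → ((Fin 3 → ℝ) →L[ℝ] ℝ))
    (X : Fin 3 → (Fin 3 → ℝ) → (Fin 3 → ℝ)) (k i j : Fin 3) (u : Fin 3 → ℝ) : ℝ :=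
  christoffel Ω X k i j u - christoffel Ω X k j i u

/-- `X` is a smooth frame on the open set `U`, with the smooth dual coframe `Ω`. -/
structure IsDualFrame (U : Set (Fin 3 → ℝ))
    (Ω : Fin 3 → (Fin 3 → ℝ) → ((Fin 3 → ℝ) →L[ℝ] ℝ))
    (X : Fin 3 → (Fin 3 → ℝ) → (Fin 3 → ℝ)) : Prop where
  isOpen : IsOpen U
  smooth_form : ∀ i, ContDiffOn ℝ ∞ (Ω i) U
  smooth_field : ∀ i, ContDiffOn ℝ ∞ (X i) U
  dual : ∀ u ∈ U, ∀ i j, Ω i u (X j u) = if i = j then 1 else 0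

theorem Fin.sum_three_of_ne {M : Type*} [AddCommMonoid M] {i j k : Fin 3} (hij : i ≠ j)
    (hjk : j ≠ k) (hik : i ≠ k) (F : Fin 3 → M) : ∑ n, F n = F i + F j + F k := by
  have h : (Finset.univ : Finset (Fin 3)) = {i, j, k} := by
    revert i j k; decide
  rw [h, Finset.sum_insert (by simp [hij, hik]), Finset.sum_insert (by simp [hjk]),
    Finset.sum_singleton, add_assoc]

section Commutator

variable {F : Type*} [NormedAddCommGroup F] [NormedSpace ℝ F]
  {U : Set (Fin 3 → ℝ)} {X : Fin 3 → (Fin 3 → ℝ) → (Fin 3 → ℝ)} {u : Fin 3 → ℝ}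

theorem ContDiffOn.differentiableAt_of_isOpen {g : (Fin 3 → ℝ) → F} (hg : ContDiffOn ℝ ∞ g U)
    (hU : IsOpen U) (hu : u ∈ U) : DifferentiableAt ℝ g u :=
  (hg.contDiffAt (hU.mem_nhds hu)).differentiableAt (by simp)

theorem contDiffOn_fderiv_of_isOpen {g : (Fin 3 → ℝ) → F} (hg : ContDiffOn ℝ ∞ g U)
    (hU : IsOpen U) : ContDiffOn ℝ ∞ (fderiv ℝ g) U :=
  hg.fderiv_of_isOpen hU (by simp)

theorem contDiffOn_frameDeriv {g : (Fin 3 → ℝ) → F} (hU : IsOpen U) (hg : ContDiffOn ℝ ∞ g U)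
    {i : Fin 3} (hX : ContDiffOn ℝ ∞ (X i) U) : ContDiffOn ℝ ∞ (frameDeriv X i g) U :=
  (contDiffOn_fderiv_of_isOpen hg hU).clm_apply hX

/-- `X_i(X_j(g)) - X_j(X_i(g)) = [X_i, X_j](g)`, by the symmetry of the second derivative. -/
theorem frameDeriv_comm {g : (Fin 3 → ℝ) → F} (hU : IsOpen U) (hg : ContDiffOn ℝ ∞ g U)
    (hX : ∀ i, ContDiffOn ℝ ∞ (X i) U) (hu : u ∈ U) (i j : Fin 3) :
    frameDeriv X i (frameDeriv X j g) u - frameDeriv X j (frameDeriv X i g) u =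
      fderiv ℝ g u (frameDeriv X i (X j) u - frameDeriv X j (X i) u) := by
  have hd : DifferentiableAt ℝ (fderiv ℝ g) u :=
    (contDiffOn_fderiv_of_isOpen hg hU).differentiableAt_of_isOpen hU hu
  have key : ∀ a b : Fin 3, frameDeriv X a (frameDeriv X b g) u =
      fderiv ℝ (fderiv ℝ g) u (X a u) (X b u) + fderiv ℝ g u (frameDeriv X a (X b) u) := by
    intro a b
    have : frameDeriv X b g = fun x => fderiv ℝ g x (X b x) := rfl
    rw [this, frameDeriv, fderiv_clm_apply hd ((hX b).differentiableAt_of_isOpen hU hu)]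
    simp [frameDeriv, add_comm]
  have hs : IsSymmSndFDerivAt ℝ g u :=
    (hg.contDiffAt (hU.mem_nhds hu)).isSymmSndFDerivAt
      (by simpa using WithTop.coe_le_coe.2 (le_top (a := (2 : ℕ∞))))
  rw [key, key, hs (X i u) (X j u), map_sub]
  abel

end Commutator

namespace IsDualFrame

variable {U : Set (Fin 3 → ℝ)} {Ω : Fin 3 → (Fin 3 → ℝ) → ((Fin 3 → ℝ) →L[ℝ] ℝ)}
  {X : Fin 3 → (Fin 3 → ℝ) → (Fin 3 → ℝ)} {u : Fin 3 → ℝ}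

theorem eq_zero_of_forall_form (h : IsDualFrame U Ω X) (hu : u ∈ U) {w : Fin 3 → ℝ}
    (hw : ∀ i, Ω i u w = 0) : w = 0 := by
  let Φ : (Fin 3 → ℝ) →ₗ[ℝ] (Fin 3 → ℝ) := LinearMap.pi fun i => (Ω i u : (Fin 3 → ℝ) →ₗ[ℝ] ℝ)
  have hsurj : Function.Surjective Φ := by
    intro y
    refine ⟨∑ j, y j • X j u, ?_⟩
    ext i
    simp [Φ, h.dual u hu]
  have hinj : Function.Injective Φ := LinearMap.injective_iff_surjective.mpr hsurj
  apply hinj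
  ext i
  simpa [Φ] using hw i

theorem expand (h : IsDualFrame U Ω X) (hu : u ∈ U) (w : Fin 3 → ℝ) :
    w = ∑ j, Ω j u w • X j u := by
  rw [← sub_eq_zero]
  apply h.eq_zero_of_forall_form hu
  intro i
  simp [h.dual u hu]

theorem frameDeriv_field (h : IsDualFrame U Ω X) (hu : u ∈ U) (i j : Fin 3) :
    frameDeriv X i (X j) u = ∑ k, christoffel Ω X k i j u • X k u :=
  h.expand hu _

theorem contDiffOn_christoffel (h : IsDualFrame U Ω X) (k i j : Fin 3) :
    ContDiffOn ℝ ∞ (christoffel Ω X k i j) U :=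
  (h.smooth_form k).clm_apply (contDiffOn_frameDeriv h.isOpen (h.smooth_field j) (h.smooth_field i))

theorem contDiffOn_structCoeff (h : IsDualFrame U Ω X) (k i j : Fin 3) :
    ContDiffOn ℝ ∞ (structCoeff Ω X k i j) U :=
  (h.contDiffOn_christoffel k i j).sub (h.contDiffOn_christoffel k j i)

theorem fderiv_eq_sum (h : IsDualFrame U Ω X) (hu : u ∈ U) (g : (Fin 3 → ℝ) → ℝ) :
    fderiv ℝ g u = ∑ j, frameDeriv X j g u • Ω j u := by
  ext w
  conv_lhs => rw [h.expand hu w]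
  simp [frameDeriv, mul_comm]

theorem commutator (h : IsDualFrame U Ω X) (hu : u ∈ U) {g : (Fin 3 → ℝ) → ℝ}
    (hg : ContDiffOn ℝ ∞ g U) (i j : Fin 3) :
    frameDeriv X i (frameDeriv X j g) u - frameDeriv X j (frameDeriv X i g) u =
      ∑ n, structCoeff Ω X n i j u * frameDeriv X n g u := by
  rw [frameDeriv_comm h.isOpen hg h.smooth_field hu, h.frameDeriv_field hu i j,
    h.frameDeriv_field hu j i, ← Finset.sum_sub_distrib]
  simp [structCoeff, frameDeriv, ← sub_smul]

/-- The vanishing of the curvature of the flat connection, in components. -/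
theorem curvature (h : IsDualFrame U Ω X) (hu : u ∈ U) (i j l m : Fin 3) :
    frameDeriv X i (christoffel Ω X m j l) u - frameDeriv X j (christoffel Ω X m i l) u +
      ∑ n, (christoffel Ω X n j l u * christoffel Ω X m i n u -
        christoffel Ω X n i l u * christoffel Ω X m j n u -
        structCoeff Ω X n i j u * christoffel Ω X m n l u) = 0 := by
  have hc := frameDeriv_comm h.isOpen (h.smooth_field l) h.smooth_field hu i j
  have key : ∀ a b : Fin 3, Ω m u (frameDeriv X a (frameDeriv X b (X l)) u) =
      frameDeriv X a (christoffel Ω X m b l) u +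
        ∑ n, christoffel Ω X n b l u * christoffel Ω X m a n u := by
    intro a b
    have he : frameDeriv X b (X l) =ᶠ[nhds u]
        fun x => ∑ n, christoffel Ω X n b l x • X n x := by
      filter_upwards [h.isOpen.mem_nhds hu] with x hx using h.frameDeriv_field hx b l
    have hG : ∀ n, DifferentiableAt ℝ (christoffel Ω X n b l) u := fun n =>
      (h.contDiffOn_christoffel n b l).differentiableAt_of_isOpen h.isOpen hu
    have hX : ∀ n, DifferentiableAt ℝ (X n) u := fun n =>
      (h.smooth_field n).differentiableAt_of_isOpen h.isOpen hu
    have hd : frameDeriv X a (frameDeriv X b (X l)) u =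
        ∑ n, (christoffel Ω X n b l u • frameDeriv X a (X n) u +
          frameDeriv X a (christoffel Ω X n b l) u • X n u) := by
      rw [frameDeriv, he.fderiv_eq, fderiv_fun_sum fun n _ => (hG n).fun_smul (hX n)]
      simp only [sum_apply]
      refine Finset.sum_congr rfl fun n _ => ?_
      rw [fderiv_fun_smul (hG n) (hX n)]
      simp [frameDeriv]
    rw [hd]
    simp only [map_sum, map_add, map_smul, h.dual u hu, smul_eq_mul, mul_ite, mul_one, mul_zero,
      Finset.sum_add_distrib, Finset.sum_ite_eq, Finset.mem_univ, if_true]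
    rw [add_comm]
    rfl
  have hr : Ω m u (fderiv ℝ (X l) u (frameDeriv X i (X j) u - frameDeriv X j (X i) u)) =
      ∑ n, structCoeff Ω X n i j u * christoffel Ω X m n l u := by
    rw [h.frameDeriv_field hu i j, h.frameDeriv_field hu j i, ← Finset.sum_sub_distrib]
    simp [structCoeff, christoffel, frameDeriv, ← sub_smul]
  have := congrArg (Ω m u) hc
  rw [map_sub, key, key, hr] at this
  simp only [Finset.sum_sub_distrib]
  linarith

theorem fderiv_form_apply (h : IsDualFrame U Ω X) (hu : u ∈ U) (k a b : Fin 3) :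
    fderiv ℝ (Ω k) u (X a u) (X b u) = -christoffel Ω X k a b u := by
  have hd : DifferentiableAt ℝ (Ω k) u :=
    (h.smooth_form k).differentiableAt_of_isOpen h.isOpen hu
  have he : (fun x => Ω k x (X b x)) =ᶠ[nhds u] fun _ => if k = b then 1 else 0 := by
    filter_upwards [h.isOpen.mem_nhds hu] with x hx using h.dual x hx k b
  have h0 := congrArg (fun L : (Fin 3 → ℝ) →L[ℝ] ℝ => L (X a u)) he.fderiv_eq
  simp only [fderiv_fun_const] at h0
  rw [fderiv_clm_apply hd ((h.smooth_field b).differentiableAt_of_isOpen h.isOpen hu)] at h0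
  simp only [add_apply, ContinuousLinearMap.comp_apply, ContinuousLinearMap.flip_apply] at h0
  have : christoffel Ω X k a b u = Ω k u (fderiv ℝ (X b) u (X a u)) := rfl
  rw [this]
  simp at h0
  linarith

/-- The exterior derivatives of the coframe are given by the structure coefficients. -/
theorem dForm_eq_structCoeff (h : IsDualFrame U Ω X) (hu : u ∈ U) (k : Fin 3) (v w : Fin 3 → ℝ) :
    dForm (Ω k) u v w = -(structCoeff Ω X k 0 1 u * wedge (Ω 0 u) (Ω 1 u) v w +
      structCoeff Ω X k 1 2 u * wedge (Ω 1 u) (Ω 2 u) v w +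
      structCoeff Ω X k 2 0 u * wedge (Ω 2 u) (Ω 0 u) v w) := by
  have key : ∀ v w, fderiv ℝ (Ω k) u v w =
      ∑ a, ∑ b, Ω a u v * (Ω b u w * -christoffel Ω X k a b u) := by
    intro v w
    conv_lhs => rw [h.expand hu v, h.expand hu w]
    simp only [map_sum, map_smul, sum_apply, smul_apply, smul_eq_mul, h.fderiv_form_apply hu]
    rw [Finset.sum_comm]
    simp only [Finset.mul_sum]
    refine Finset.sum_congr rfl fun a _ => Finset.sum_congr rfl fun b _ => ?_
    ring
  rw [dForm_eq ((h.smooth_form k).differentiableAt_of_isOpen h.isOpen hu), key, key]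
  simp only [Fin.sum_univ_three, wedge, structCoeff]
  ring

end IsDualFrame

/-! ### Frame derivatives of rational expressions -/

/-- `g` is differentiable at `u`, with the derivatives `d i` along the fields `X i`. -/
def HasFrameDeriv (X : Fin 3 → (Fin 3 → ℝ) → (Fin 3 → ℝ)) (g : (Fin 3 → ℝ) → ℝ) (d : Fin 3 → ℝ)
    (u : Fin 3 → ℝ) : Prop :=
  DifferentiableAt ℝ g u ∧ ∀ i, frameDeriv X i g u = d i

namespace HasFrameDeriv

variable {X : Fin 3 → (Fin 3 → ℝ) → (Fin 3 → ℝ)} {g h : (Fin 3 → ℝ) → ℝ} {d e : Fin 3 → ℝ}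
  {u : Fin 3 → ℝ}

theorem of_contDiffOn {U : Set (Fin 3 → ℝ)} (hU : IsOpen U) (hg : ContDiffOn ℝ ∞ g U)
    (hu : u ∈ U) : HasFrameDeriv X g (fun i => frameDeriv X i g u) u :=
  ⟨hg.differentiableAt_of_isOpen hU hu, fun _ => rfl⟩

theorem const (c : ℝ) : HasFrameDeriv X (fun _ => c) (fun _ => 0) u :=
  ⟨differentiableAt_const c, fun i => by simp [frameDeriv]⟩

theorem add (hg : HasFrameDeriv X g d u) (hh : HasFrameDeriv X h e u) :
    HasFrameDeriv X (fun x => g x + h x) (fun i => d i + e i) u :=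
  ⟨hg.1.fun_add hh.1, fun i => by
    dsimp only
    rw [← hg.2, ← hh.2, frameDeriv, fderiv_fun_add hg.1 hh.1]; rfl⟩

theorem sub (hg : HasFrameDeriv X g d u) (hh : HasFrameDeriv X h e u) :
    HasFrameDeriv X (fun x => g x - h x) (fun i => d i - e i) u :=
  ⟨hg.1.fun_sub hh.1, fun i => by
    dsimp only
    rw [← hg.2, ← hh.2, frameDeriv, fderiv_fun_sub hg.1 hh.1]; rfl⟩

theorem mul (hg : HasFrameDeriv X g d u) (hh : HasFrameDeriv X h e u) :
    HasFrameDeriv X (fun x => g x * h x) (fun i => d i * h u + g u * e i) u :=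
  ⟨hg.1.fun_mul hh.1, fun i => by
    dsimp only
    rw [← hg.2, ← hh.2, frameDeriv, fderiv_fun_mul hg.1 hh.1]
    simp [frameDeriv]; ring⟩

theorem inv (hh : HasFrameDeriv X h e u) (h0 : h u ≠ 0) :
    HasFrameDeriv X (fun x => (h x)⁻¹) (fun i => -e i / h u ^ 2) u := by
  have hd := (hasDerivAt_inv h0).comp_hasFDerivAt u hh.1.hasFDerivAt
  refine ⟨hd.differentiableAt, fun i => ?_⟩
  change fderiv ℝ (Inv.inv ∘ h) u (X i u) = _
  rw [hd.fderiv]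
  simp only [← hh.2]
  simp [frameDeriv]
  ring

theorem div (hg : HasFrameDeriv X g d u) (hh : HasFrameDeriv X h e u) (h0 : h u ≠ 0) :
    HasFrameDeriv X (fun x => g x / h x) (fun i => (d i * h u - g u * e i) / h u ^ 2) u := by
  have := hg.mul (hh.inv h0)
  simp only [← div_eq_mul_inv] at this
  refine ⟨this.1, fun i => ?_⟩
  rw [this.2]
  field_simp
  ring

theorem eq_of_eqOn {U : Set (Fin 3 → ℝ)} (hU : IsOpen U) (hu : u ∈ U)
    (hg : HasFrameDeriv X g d u) {h : (Fin 3 → ℝ) → ℝ} (he : ∀ x ∈ U, h x = g x) (i : Fin 3) :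
    frameDeriv X i h u = d i := by
  have : h =ᶠ[nhds u] g := by
    filter_upwards [hU.mem_nhds hu] with x hx using he x hx
  rw [← hg.2, frameDeriv, this.fderiv_eq, frameDeriv]

end HasFrameDeriv

/-! ### Frames of T-systems -/

/-- The eigenframe of a T-system with eigenvalues `lam`, in terms of the flat connection: the
symmetry of `∇v` (`codazzi` and `codazzi_self`), the straightness of the rarefaction curves
(`geodesic`), and linear degeneracy. -/
structure IsTFrame (U : Set (Fin 3 → ℝ)) (lam : Fin 3 → (Fin 3 → ℝ) → ℝ)
    (Ω : Fin 3 → (Fin 3 → ℝ) → ((Fin 3 → ℝ) →L[ℝ] ℝ))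
    (X : Fin 3 → (Fin 3 → ℝ) → (Fin 3 → ℝ)) : Prop extends IsDualFrame U Ω X where
  smooth_eigenvalue : ∀ i, ContDiffOn ℝ ∞ (lam i) U
  distinct : ∀ u ∈ U, ∀ i j, i ≠ j → lam i u ≠ lam j u
  codazzi : ∀ u ∈ U, ∀ i j k, i ≠ j → j ≠ k → i ≠ k →
    (lam j u - lam k u) * christoffel Ω X k i j u = (lam i u - lam k u) * christoffel Ω X k j i u
  codazzi_self : ∀ u ∈ U, ∀ i j, i ≠ j →
    frameDeriv X i (lam j) u = (lam i u - lam j u) * christoffel Ω X j j i u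
  geodesic : ∀ u ∈ U, ∀ i k, k ≠ i → christoffel Ω X k i i u = 0
  linearly_degenerate : ∀ u ∈ U, ∀ i, frameDeriv X i (lam i) u = 0

namespace IsTFrame

variable {U : Set (Fin 3 → ℝ)} {lam : Fin 3 → (Fin 3 → ℝ) → ℝ}
  {Ω : Fin 3 → (Fin 3 → ℝ) → ((Fin 3 → ℝ) →L[ℝ] ℝ)}
  {X : Fin 3 → (Fin 3 → ℝ) → (Fin 3 → ℝ)} {u : Fin 3 → ℝ} {i j k : Fin 3}

theorem sub_ne_zero (h : IsTFrame U lam Ω X) (hu : u ∈ U) (hij : i ≠ j) :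
    lam i u - lam j u ≠ 0 :=
  _root_.sub_ne_zero.mpr (h.distinct u hu i j hij)

theorem christoffel_distinct (h : IsTFrame U lam Ω X) (hu : u ∈ U) (hij : i ≠ j) (hjk : j ≠ k)
    (hik : i ≠ k) : christoffel Ω X k i j u =
      (lam i u - lam k u) / (lam i u - lam j u) * structCoeff Ω X k i j u := by
  have h1 := h.sub_ne_zero hu hij
  have h2 := h.codazzi u hu i j k hij hjk hik
  rw [structCoeff]
  field_simp
  linear_combination -h2

theorem christoffel_self_left (h : IsTFrame U lam Ω X) (hu : u ∈ U) (hij : i ≠ j) :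
    christoffel Ω X j j i u = frameDeriv X i (lam j) u / (lam i u - lam j u) := by
  have h1 := h.sub_ne_zero hu hij
  rw [h.codazzi_self u hu i j hij]
  field_simp

theorem hasFrameDeriv_lam (h : IsTFrame U lam Ω X) (hu : u ∈ U) (i : Fin 3) :
    HasFrameDeriv X (lam i) (fun a => frameDeriv X a (lam i) u) u :=
  .of_contDiffOn h.isOpen (h.smooth_eigenvalue i) hu

theorem smooth_frameDeriv (h : IsTFrame U lam Ω X) (i j : Fin 3) :
    ContDiffOn ℝ ∞ (frameDeriv X j (lam i)) U :=
  contDiffOn_frameDeriv h.isOpen (h.smooth_eigenvalue i) (h.smooth_field j)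

theorem hasFrameDeriv_frameDeriv (h : IsTFrame U lam Ω X) (hu : u ∈ U) (i j : Fin 3) :
    HasFrameDeriv X (frameDeriv X j (lam i))
      (fun a => frameDeriv X a (frameDeriv X j (lam i)) u) u :=
  .of_contDiffOn h.isOpen (h.smooth_frameDeriv i j) hu

theorem frameDeriv_christoffel_self_left (h : IsTFrame U lam Ω X) (hu : u ∈ U) (hij : i ≠ j)
    (a : Fin 3) : frameDeriv X a (christoffel Ω X j j i) u =
      frameDeriv X a (frameDeriv X i (lam j)) u / (lam i u - lam j u) -
        frameDeriv X i (lam j) u * (frameDeriv X a (lam i) u - frameDeriv X a (lam j) u) /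
          (lam i u - lam j u) ^ 2 := by
  have h1 := h.sub_ne_zero hu hij
  rw [((h.hasFrameDeriv_frameDeriv hu j i).div ((h.hasFrameDeriv_lam hu i).sub
    (h.hasFrameDeriv_lam hu j)) h1).eq_of_eqOn h.isOpen hu
      (fun x hx => h.christoffel_self_left hx hij) a]
  field_simp

/-- The derivatives of `Γ^k_{ij}` when the structure coefficient `c^k_{ij}` is constant. -/
theorem frameDeriv_christoffel_distinct (h : IsTFrame U lam Ω X) (hu : u ∈ U) (hij : i ≠ j)
    (hjk : j ≠ k) (hik : i ≠ k) {c : ℝ} (hc : ∀ x ∈ U, structCoeff Ω X k i j x = c) (a : Fin 3) :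
    frameDeriv X a (christoffel Ω X k i j) u =
      c * ((frameDeriv X a (lam i) u - frameDeriv X a (lam k) u) / (lam i u - lam j u) -
        (lam i u - lam k u) * (frameDeriv X a (lam i) u - frameDeriv X a (lam j) u) /
          (lam i u - lam j u) ^ 2) := by
  have h1 := h.sub_ne_zero hu hij
  have hl := h.hasFrameDeriv_lam hu
  rw [((((hl i).sub (hl k)).div ((hl i).sub (hl j)) h1).mul (.const c)).eq_of_eqOn h.isOpen hu
      (fun x hx => by rw [h.christoffel_distinct hx hij hjk hik, hc x hx]) a]
  field_simp
  ring

theorem frameDeriv_eq_zero_of_eqOn {g : (Fin 3 → ℝ) → ℝ} {c : ℝ} (hU : IsOpen U)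
    (hg : ∀ x ∈ U, g x = c) (hu : u ∈ U) (a : Fin 3) : frameDeriv X a g u = 0 :=
  (HasFrameDeriv.const c).eq_of_eqOn hU hu hg a

theorem christoffel_self_right (Ω : Fin 3 → (Fin 3 → ℝ) → ((Fin 3 → ℝ) →L[ℝ] ℝ))
    (X : Fin 3 → (Fin 3 → ℝ) → (Fin 3 → ℝ)) (j i : Fin 3) (u : Fin 3 → ℝ) :
    christoffel Ω X j i j u =
    structCoeff Ω X j i j u + christoffel Ω X j j i u := by
  simp [structCoeff]

theorem structCoeff_antisymm : structCoeff Ω X k j i u = -structCoeff Ω X k i j u := by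
  simp [structCoeff]

/-- The vanishing of the component of `R(X_i, X_j) X_i` along `X_k`, for a constant nonzero
`c^k_{ij}`. -/
theorem christoffel_diag_of_const (h : IsTFrame U lam Ω X) (hij : i ≠ j) (hjk : j ≠ k) (hik : i ≠ k)
    {c : ℝ} (hc0 : c ≠ 0) (hc : ∀ x ∈ U, structCoeff Ω X k i j x = c) (hu : u ∈ U) :
    christoffel Ω X i i i u = structCoeff Ω X k i k u - structCoeff Ω X j i j u +
      2 * frameDeriv X i (lam j) u * (1 / (lam i u - lam j u) + 1 / (lam j u - lam k u)) +
      2 * frameDeriv X i (lam k) u * (1 / (lam i u - lam k u) + 1 / (lam k u - lam j u)) := by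
  have h1 := h.sub_ne_zero hu hij
  have h2 := h.sub_ne_zero hu hjk
  have h3 := h.sub_ne_zero hu hik
  have hc' : ∀ x ∈ U, structCoeff Ω X k j i x = -c := fun x hx => by
    rw [structCoeff_antisymm, hc x hx]
  have hcu := hc u hu
  have hcu' := hc' u hu
  have R := h.curvature hu i j i k
  rw [Fin.sum_three_of_ne hij hjk hik,
    h.frameDeriv_christoffel_distinct hu hij.symm hik hjk hc' i,
    frameDeriv_eq_zero_of_eqOn h.isOpen (fun x hx => h.geodesic x hx i k hik.symm) hu,
    h.christoffel_distinct hu hij.symm hik hjk, h.christoffel_distinct hu hij hjk hik, hcu, hcu',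
    h.geodesic u hu i k hik.symm, h.geodesic u hu i j hij.symm,
    christoffel_self_right Ω X k i, h.christoffel_self_left hu hij, h.christoffel_self_left hu hik,
    h.linearly_degenerate u hu i] at R
  have h1' : lam j u - lam i u ≠ 0 := h.sub_ne_zero hu hij.symm
  have h2' : lam k u - lam j u ≠ 0 := h.sub_ne_zero hu hjk.symm
  set x := lam i u
  set y := lam j u
  set z := lam k u
  set p := frameDeriv X i (lam j) u
  set q := frameDeriv X i (lam k) u
  set s := structCoeff Ω X k i k u
  set t := structCoeff Ω X j i j u
  set G := christoffel Ω X i i i u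
  linear_combination (norm := (field_simp; ring)) ((y - x) / (c * (y - z))) * R

end IsTFrame

/-! ### Normalized frames of T-systems -/

/-- The frame of a T-system whose coframe is normalized so that the structure coefficients
`c k i j` with three distinct indices are nonzero constants. -/
structure IsConstTFrame (U : Set (Fin 3 → ℝ)) (lam : Fin 3 → (Fin 3 → ℝ) → ℝ)
    (Ω : Fin 3 → (Fin 3 → ℝ) → ((Fin 3 → ℝ) →L[ℝ] ℝ))
    (X : Fin 3 → (Fin 3 → ℝ) → (Fin 3 → ℝ)) (c : Fin 3 → Fin 3 → Fin 3 → ℝ) : Prop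
    extends IsTFrame U lam Ω X where
  const_ne_zero : ∀ i j k, i ≠ j → j ≠ k → i ≠ k → c k i j ≠ 0
  const_antisymm : ∀ i j k, i ≠ j → c k j i = -c k i j
  structCoeff_eq : ∀ u ∈ U, ∀ i j k, i ≠ j → j ≠ k → i ≠ k → structCoeff Ω X k i j u = c k i j

namespace IsConstTFrame

variable {U : Set (Fin 3 → ℝ)} {lam : Fin 3 → (Fin 3 → ℝ) → ℝ}
  {Ω : Fin 3 → (Fin 3 → ℝ) → ((Fin 3 → ℝ) →L[ℝ] ℝ)}
  {X : Fin 3 → (Fin 3 → ℝ) → (Fin 3 → ℝ)} {c : Fin 3 → Fin 3 → Fin 3 → ℝ}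
  {u : Fin 3 → ℝ} {i j k : Fin 3}

/-- The curvature component of `christoffel_diag_of_const` and the one with `j` and `k` exchanged
determine `Γ^i_{ii}`, and show that `c^j_{ij} = c^k_{ik}`
(`structCoeff_trace`). -/
theorem christoffel_diag (h : IsConstTFrame U lam Ω X c) (hij : i ≠ j) (hjk : j ≠ k) (hik : i ≠ k)
    (hu : u ∈ U) : christoffel Ω X i i i u =
      2 * frameDeriv X i (lam j) u * (1 / (lam i u - lam j u) + 1 / (lam j u - lam k u)) +
      2 * frameDeriv X i (lam k) u * (1 / (lam i u - lam k u) + 1 / (lam k u - lam j u)) := by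
  have h1 := h.toIsTFrame.christoffel_diag_of_const hij hjk hik (h.const_ne_zero i j k hij hjk hik)
    (fun x hx => h.structCoeff_eq x hx i j k hij hjk hik) hu
  have h2 := h.toIsTFrame.christoffel_diag_of_const hik hjk.symm hij
    (h.const_ne_zero i k j hik hjk.symm hij)
    (fun x hx => h.structCoeff_eq x hx i k j hik hjk.symm hij) hu
  linear_combination (h1 + h2) / 2

/-- The two coefficients `c^j_{ij}` and `c^k_{ik}` coincide. -/
theorem structCoeff_trace (h : IsConstTFrame U lam Ω X c) (hij : i ≠ j) (hjk : j ≠ k) (hik : i ≠ k)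
    (hu : u ∈ U) : structCoeff Ω X k i k u = structCoeff Ω X j i j u := by
  have h1 := h.toIsTFrame.christoffel_diag_of_const hij hjk hik (h.const_ne_zero i j k hij hjk hik)
    (fun x hx => h.structCoeff_eq x hx i j k hij hjk hik) hu
  have h2 := h.christoffel_diag hij hjk hik hu
  linear_combination h2 - h1

theorem frameDeriv_christoffel_diag (h : IsConstTFrame U lam Ω X c) (hij : i ≠ j) (hjk : j ≠ k)
    (hik : i ≠ k) (hu : u ∈ U) (a : Fin 3) :
    frameDeriv X a (christoffel Ω X i i i) u =
      2 * frameDeriv X a (frameDeriv X i (lam j)) u *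
        (1 / (lam i u - lam j u) + 1 / (lam j u - lam k u)) +
      2 * frameDeriv X a (frameDeriv X i (lam k)) u *
        (1 / (lam i u - lam k u) + 1 / (lam k u - lam j u)) -
      2 * frameDeriv X i (lam j) u *
        ((frameDeriv X a (lam i) u - frameDeriv X a (lam j) u) / (lam i u - lam j u) ^ 2 +
          (frameDeriv X a (lam j) u - frameDeriv X a (lam k) u) / (lam j u - lam k u) ^ 2) -
      2 * frameDeriv X i (lam k) u *
        ((frameDeriv X a (lam i) u - frameDeriv X a (lam k) u) / (lam i u - lam k u) ^ 2 +
          (frameDeriv X a (lam k) u - frameDeriv X a (lam j) u) / (lam k u - lam j u) ^ 2) := by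
  have h1 := h.sub_ne_zero hu hij
  have h2 := h.sub_ne_zero hu hjk
  have h3 := h.sub_ne_zero hu hik
  have h4 := h.sub_ne_zero hu hjk.symm
  have hl := h.hasFrameDeriv_lam hu
  have hm := h.hasFrameDeriv_frameDeriv hu
  have one : HasFrameDeriv X (fun _ => 1) (fun _ => 0) u := .const 1
  have two : HasFrameDeriv X (fun _ => 2) (fun _ => 0) u := .const 2
  rw [(((two.mul (hm j i)).mul ((one.div ((hl i).sub (hl j)) h1).add
    (one.div ((hl j).sub (hl k)) h2))).add ((two.mul (hm k i)).mul
      ((one.div ((hl i).sub (hl k)) h3).add (one.div ((hl k).sub (hl j)) h4)))).eq_of_eqOn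
      h.isOpen hu (fun x hx => h.christoffel_diag hij hjk hik hx) a]
  ring

/-- `λ^i_{ji}`, from the commutator of `X_i` and `X_j` applied to `λ^i`. -/
theorem second_deriv_mixed (h : IsConstTFrame U lam Ω X c) (hij : i ≠ j) (hjk : j ≠ k)
    (hik : i ≠ k) (hu : u ∈ U) : frameDeriv X i (frameDeriv X j (lam i)) u =
      structCoeff Ω X j i j u * frameDeriv X j (lam i) u + c k i j * frameDeriv X k (lam i) u := by
  have h1 := h.commutator hu (h.smooth_eigenvalue i) i j
  rw [Fin.sum_three_of_ne hij hjk hik, h.linearly_degenerate u hu i,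
    h.structCoeff_eq u hu i j k hij hjk hik, IsTFrame.frameDeriv_eq_zero_of_eqOn h.isOpen
      (fun x hx => h.linearly_degenerate x hx i) hu] at h1
  linear_combination h1

/-- The commutator of `X_i` and `X_j` applied to `λ^k`. -/
theorem second_deriv_comm (h : IsConstTFrame U lam Ω X c) (hij : i ≠ j) (hjk : j ≠ k)
    (hik : i ≠ k) (hu : u ∈ U) : frameDeriv X i (frameDeriv X j (lam k)) u =
      frameDeriv X j (frameDeriv X i (lam k)) u + structCoeff Ω X j i j u * frameDeriv X j (lam k) u
        - structCoeff Ω X i j i u * frameDeriv X i (lam k) u := by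
  have h1 := h.commutator hu (h.smooth_eigenvalue k) i j
  rw [Fin.sum_three_of_ne hij hjk hik, h.linearly_degenerate u hu k,
    IsTFrame.structCoeff_antisymm (i := j) (j := i) (k := i)] at h1
  linear_combination h1

/-- The Jacobi identity for the fields of the frame, along `X_k`. It is the cyclic sum of curvature
components. -/
theorem jacobi (h : IsConstTFrame U lam Ω X c) (hij : i ≠ j) (hjk : j ≠ k)
    (hik : i ≠ k) (hu : u ∈ U) :
    frameDeriv X i (structCoeff Ω X i j i) u - frameDeriv X j (structCoeff Ω X j i j) u =
      2 * c k i j * structCoeff Ω X i k i u := by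
  have hΓ : ∀ a b d, HasFrameDeriv X (christoffel Ω X a b d)
      (fun s => frameDeriv X s (christoffel Ω X a b d) u) u := fun a b d =>
    .of_contDiffOn h.isOpen (h.contDiffOn_christoffel a b d) hu
  have hd : ∀ s a b d, frameDeriv X s (structCoeff Ω X a b d) u =
      frameDeriv X s (christoffel Ω X a b d) u - frameDeriv X s (christoffel Ω X a d b) u :=
    fun s a b d => ((hΓ a b d).sub (hΓ a d b)).eq_of_eqOn h.isOpen hu (fun x _ => rfl) s
  have e1 : frameDeriv X i (structCoeff Ω X i j i) u = frameDeriv X i (structCoeff Ω X k j k) u :=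
    (HasFrameDeriv.of_contDiffOn h.isOpen (h.contDiffOn_structCoeff k j k) hu).eq_of_eqOn
      h.isOpen hu (fun x hx => h.structCoeff_trace hjk hik.symm hij.symm hx) i
  have e2 : frameDeriv X j (structCoeff Ω X j i j) u = frameDeriv X j (structCoeff Ω X k i k) u :=
    (HasFrameDeriv.of_contDiffOn h.isOpen (h.contDiffOn_structCoeff k i k) hu).eq_of_eqOn
      h.isOpen hu (fun x hx => h.structCoeff_trace hik hjk.symm hij hx) j
  have e3 := IsTFrame.frameDeriv_eq_zero_of_eqOn (X := X) h.isOpen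
    (fun x hx => h.structCoeff_eq x hx i j k hij hjk hik) hu k
  have s1 := h.structCoeff_trace hjk hik.symm hij.symm hu
  have s2 := h.structCoeff_trace hik hjk.symm hij hu
  have s3 := h.structCoeff_trace hik.symm hij hjk.symm hu
  have s4 := h.structCoeff_eq u hu i j k hij hjk hik
  have r1 := h.curvature hu i j k k
  have r2 := h.curvature hu j k i k
  have r3 := h.curvature hu k i j k
  rw [Fin.sum_three_of_ne hij hjk hik] at r1 r2 r3
  rw [e1, e2, hd, hd, ← s4]
  rw [hd] at e3
  simp only [structCoeff] at s1 s2 s3 r1 r2 r3 ⊢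
  linear_combination r1 + r2 + r3 - e3 +
    (christoffel Ω X k i j u - christoffel Ω X k j i u) * s3 -
    (christoffel Ω X k i k u - christoffel Ω X k k i u) * s1 +
    (christoffel Ω X k j k u - christoffel Ω X k k j u) * s2

/-- The vanishing of the component of `R(X_i, X_j) X_i` along `X_i`. -/
theorem curvature_diag (h : IsConstTFrame U lam Ω X c) (hij : i ≠ j) (hjk : j ≠ k) (hik : i ≠ k)
    (hu : u ∈ U) :
    frameDeriv X i (structCoeff Ω X i j i) u + frameDeriv X i (christoffel Ω X i i j) u
      - frameDeriv X j (christoffel Ω X i i i) u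
      + structCoeff Ω X i j i u * christoffel Ω X i i i u
      + christoffel Ω X j j i u * christoffel Ω X i i j u
      - structCoeff Ω X j i j u * (structCoeff Ω X i j i u + christoffel Ω X i i j u)
      + christoffel Ω X k j i u * christoffel Ω X i i k u
      - c k i j * (structCoeff Ω X i k i u + christoffel Ω X i i k u) = 0 := by
  have r := h.curvature hu i j i i
  have hs : frameDeriv X i (christoffel Ω X i j i) u = frameDeriv X i (structCoeff Ω X i j i) u +
      frameDeriv X i (christoffel Ω X i i j) u :=
    ((HasFrameDeriv.of_contDiffOn h.isOpen (h.contDiffOn_structCoeff i j i) hu).add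
      (HasFrameDeriv.of_contDiffOn h.isOpen (h.contDiffOn_christoffel i i j) hu)).eq_of_eqOn
      h.isOpen hu (fun x _ => IsTFrame.christoffel_self_right Ω X i j x) i
  rw [Fin.sum_three_of_ne hij hjk hik, hs, IsTFrame.christoffel_self_right Ω X i j u,
    IsTFrame.christoffel_self_right Ω X i k u, h.geodesic u hu i j hij.symm,
    h.geodesic u hu i k hik.symm, h.structCoeff_eq u hu i j k hij hjk hik,
    IsTFrame.structCoeff_antisymm (i := j) (j := i) (k := i)] at r
  linear_combination r

/-- The vanishing of the component of `R(X_k, X_i) X_j` along `X_k`. -/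
theorem curvature_distinct (h : IsConstTFrame U lam Ω X c) (hij : i ≠ j) (hjk : j ≠ k)
    (hik : i ≠ k) (hu : u ∈ U) :
    frameDeriv X k (christoffel Ω X k i j) u - frameDeriv X i (christoffel Ω X k k j) u
      + christoffel Ω X i i j u * christoffel Ω X k k i u
      - structCoeff Ω X i k i u * christoffel Ω X k i j u
      + (structCoeff Ω X j i j u + christoffel Ω X j j i u) * christoffel Ω X k k j u
      - (structCoeff Ω X j k j u + christoffel Ω X j j k u) * christoffel Ω X k i j u
      + christoffel Ω X k i j u * christoffel Ω X k k k u
      - christoffel Ω X k k j u * christoffel Ω X k k i u = 0 := by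
  have r := h.curvature hu k i j k
  rw [Fin.sum_three_of_ne hij hjk hik, IsTFrame.christoffel_self_right Ω X j i u,
    IsTFrame.christoffel_self_right Ω X j k u, IsTFrame.christoffel_self_right Ω X k i u,
    h.geodesic u hu j k hjk.symm, h.geodesic u hu i k hik.symm,
    IsTFrame.structCoeff_antisymm (i := i) (j := k) (k := k)] at r
  linear_combination r

/-- The trace part of the structure coefficients vanishes. The components of `R(X_i, X_j) X_i`
along `X_i` and of `R(X_j, X_i) X_j` along `X_j` contain, modulo `second_deriv_mixed`, no other
derivatives of order two of the eigenvalues than those of `λ^k` in the directions `X_i` and `X_j`,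
and no other derivatives of the structure coefficients than `X_i(c^i_{ji})`, `X_j(c^j_{ij})`.
The Jacobi identity and the component of `R(X_k, X_i) X_j` along `X_k` eliminate these,
and all first derivatives of the eigenvalues cancel as well. -/
theorem structCoeff_trace_eq_zero (h : IsConstTFrame U lam Ω X c) (hij : i ≠ j) (hjk : j ≠ k)
    (hik : i ≠ k) (hu : u ∈ U) : structCoeff Ω X i k i u = 0 := by
  have hJ := h.jacobi hij hjk hik hu
  have hC := h.curvature_diag hij hjk hik hu
  have hC' := h.curvature_diag hij.symm hik hjk hu
  have hE := h.curvature_distinct hij hjk hik hu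
  have hc0 := h.const_ne_zero i j k hij hjk hik
  have ca := h.const_antisymm i j k hij
  have m1 := h.second_deriv_mixed hij hjk hik hu
  have m2 := h.second_deriv_mixed hij.symm hik hjk hu
  have m3 := h.second_deriv_comm hij hjk hik hu
  have t1 := h.structCoeff_trace hik.symm hij hjk.symm hu
  have d1 := h.sub_ne_zero hu hij
  have d2 := h.sub_ne_zero hu hjk
  have d3 := h.sub_ne_zero hu hik
  have e1 := h.sub_ne_zero hu hij.symm
  have e2 := h.sub_ne_zero hu hjk.symm
  have e3 := h.sub_ne_zero hu hik.symm
  have T := h.toIsTFrame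
  have cc := fun a b d hab hbd had => h.structCoeff_eq u hu a b d hab hbd had
  rw [T.frameDeriv_christoffel_self_left hu hij.symm, h.frameDeriv_christoffel_diag hij hjk hik hu,
    h.christoffel_diag hij hjk hik hu, T.christoffel_self_left hu hij,
    T.christoffel_self_left hu hij.symm, T.christoffel_distinct hu hij.symm hik hjk,
    T.christoffel_self_left hu hik.symm, cc j i k hij.symm hik hjk, ca, m1,
    T.linearly_degenerate u hu i, T.linearly_degenerate u hu j] at hC
  rw [T.frameDeriv_christoffel_self_left hu hij, h.frameDeriv_christoffel_diag hij.symm hik hjk hu,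
    h.christoffel_diag hij.symm hik hjk hu, T.christoffel_self_left hu hij,
    T.christoffel_self_left hu hij.symm, T.christoffel_distinct hu hij hjk hik,
    T.christoffel_self_left hu hjk.symm, cc i j k hij hjk hik, ca, m2,
    T.linearly_degenerate u hu i, T.linearly_degenerate u hu j, m3] at hC'
  rw [T.frameDeriv_christoffel_distinct hu hij hjk hik
      (fun x hx => h.structCoeff_eq x hx i j k hij hjk hik),
    T.frameDeriv_christoffel_self_left hu hjk, h.christoffel_diag hik.symm hij hjk.symm hu,
    T.christoffel_self_left hu hij, T.christoffel_self_left hu hij.symm,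
    T.christoffel_self_left hu hik, T.christoffel_self_left hu hjk,
    T.christoffel_self_left hu hjk.symm,
    T.christoffel_distinct hu hij hjk hik, cc i j k hij hjk hik, t1,
    T.linearly_degenerate u hu k, m3] at hE
  rw [m2, ca] at hC
  rw [m1, t1, ca] at hC'
  clear h T cc m1 m2 m3 t1 ca hij hjk hik hu
  generalize lam i u = x at *
  generalize lam j u = y at *
  generalize lam k u = z at *
  generalize c k i j = C at *
  -- the combination in which the second derivatives `X_j(X_i(λ^k))` cancel; what remains of it is
  -- a nonzero multiple of `C * structCoeff Ω X i k i u`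
  have key : C * structCoeff Ω X i k i u = 0 := by
    linear_combination (norm := (field_simp; ring))
      (-1/8) * (hC - hC' - hJ - 4 * ((x - y) / ((x - z) * (z - y))) * (y - z) * hE)
  exact (mul_eq_zero.mp key).resolve_left hc0

theorem structCoeff_eq_zero (h : IsConstTFrame U lam Ω X c) (hij : i ≠ j) (hu : u ∈ U) :
    structCoeff Ω X j i j u = 0 := by
  obtain ⟨k, hik, hjk⟩ : ∃ k : Fin 3, i ≠ k ∧ j ≠ k := by
    revert i j; decide
  exact h.structCoeff_trace_eq_zero hjk hik.symm hij.symm hu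

/-- `λ^k_{ij}` for distinct indices, from `curvature_distinct`. -/
theorem second_deriv_distinct (h : IsConstTFrame U lam Ω X c) (hij : i ≠ j) (hjk : j ≠ k)
    (hik : i ≠ k) (hu : u ∈ U) : frameDeriv X j (frameDeriv X i (lam k)) u =
      frameDeriv X i (lam k) u * frameDeriv X j (lam k) u *
          (1 / (lam k u - lam i u) + 1 / (lam k u - lam j u))
        + frameDeriv X j (lam k) u * frameDeriv X i (lam j) u *
          (1 / (lam i u - lam j u) + 1 / (lam j u - lam k u))
        - frameDeriv X i (lam k) u * frameDeriv X j (lam i) u *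
          (1 / (lam k u - lam i u) + 1 / (lam i u - lam j u))
        - c k i j * (frameDeriv X k (lam j) u * ((lam i u - lam k u) / (lam i u - lam j u)) ^ 2
          - frameDeriv X k (lam i) u * ((lam j u - lam k u) / (lam j u - lam i u)) ^ 2) := by
  have hE := h.curvature_distinct hij hjk hik hu
  have m3 := h.second_deriv_comm hij hjk hik hu
  have d1 := h.sub_ne_zero hu hij
  have d2 := h.sub_ne_zero hu hjk
  have d3 := h.sub_ne_zero hu hik
  have e1 := h.sub_ne_zero hu hij.symm
  have e2 := h.sub_ne_zero hu hjk.symm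
  have e3 := h.sub_ne_zero hu hik.symm
  have T := h.toIsTFrame
  rw [h.structCoeff_eq_zero hij hu, h.structCoeff_eq_zero hij.symm hu] at m3
  rw [T.frameDeriv_christoffel_distinct hu hij hjk hik
      (fun x hx => h.structCoeff_eq x hx i j k hij hjk hik),
    T.frameDeriv_christoffel_self_left hu hjk, h.christoffel_diag hik.symm hij hjk.symm hu,
    T.christoffel_self_left hu hij, T.christoffel_self_left hu hij.symm,
    T.christoffel_self_left hu hik, T.christoffel_self_left hu hjk,
    T.christoffel_self_left hu hjk.symm,
    T.christoffel_distinct hu hij hjk hik, h.structCoeff_eq u hu i j k hij hjk hik,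
    h.structCoeff_eq_zero hij hu, h.structCoeff_eq_zero hjk.symm hu,
    h.structCoeff_eq_zero hik.symm hu, T.linearly_degenerate u hu k, m3] at hE
  clear h T m3 hij hjk hik hu
  generalize lam i u = x at *
  generalize lam j u = y at *
  generalize lam k u = z at *
  generalize c k i j = C at *
  linear_combination (norm := (field_simp; ring)) (z - y) * hE

/-- `λ^j_{ii}`, from the component of `R(X_i, X_j) X_i` along `X_j`. -/
theorem second_deriv_twice (h : IsConstTFrame U lam Ω X c) (hij : i ≠ j) (hjk : j ≠ k)
    (hik : i ≠ k) (hu : u ∈ U) : frameDeriv X i (frameDeriv X i (lam j)) u =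
      -2 * frameDeriv X i (lam j) u * frameDeriv X i (lam k) u *
          (1 / (lam j u - lam k u) + 1 / (lam k u - lam i u))
        + 2 * frameDeriv X i (lam j) u ^ 2 / (lam j u - lam k u)
        + 2 * (c j k i * c k i j) *
          ((lam j u - lam k u) * (lam j u - lam i u) / (lam k u - lam i u)) := by
  have r := h.curvature hu i j i j
  have d1 := h.sub_ne_zero hu hij
  have d2 := h.sub_ne_zero hu hjk
  have d3 := h.sub_ne_zero hu hik
  have e1 := h.sub_ne_zero hu hij.symm
  have e2 := h.sub_ne_zero hu hjk.symm
  have e3 := h.sub_ne_zero hu hik.symm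
  have T := h.toIsTFrame
  rw [Fin.sum_three_of_ne hij hjk hik, T.frameDeriv_christoffel_self_left hu hij,
    IsTFrame.frameDeriv_eq_zero_of_eqOn h.isOpen (fun x hx => h.geodesic x hx i j hij.symm) hu,
    h.geodesic u hu i j hij.symm, h.geodesic u hu i k hik.symm,
    IsTFrame.christoffel_self_right Ω X j i u, h.structCoeff_eq_zero hij hu,
    IsTFrame.structCoeff_antisymm (i := j) (j := i) (k := i), h.structCoeff_eq_zero hij.symm hu,
    h.christoffel_diag hij hjk hik hu, T.christoffel_self_left hu hij,
    T.christoffel_distinct hu hij.symm hik hjk, T.christoffel_distinct hu hik hjk.symm hij,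
    T.christoffel_distinct hu hik.symm hij hjk.symm, h.structCoeff_eq u hu i j k hij hjk hik,
    h.structCoeff_eq u hu j i k hij.symm hik hjk, h.structCoeff_eq u hu i k j hik hjk.symm hij,
    h.structCoeff_eq u hu k i j hik.symm hij hjk.symm, h.const_antisymm i j k hij,
    h.const_antisymm k i j hik.symm, T.linearly_degenerate u hu i] at r
  clear h T hij hjk hik hu
  generalize lam i u = x at *
  generalize lam j u = y at *
  generalize lam k u = z at *
  generalize c k i j = C at *
  generalize c j k i = B at *
  linear_combination (norm := (field_simp; ring)) (x - y) * r

end IsConstTFrame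

/-! ### The eigenframe of a T-system -/

section Reindex

variable {U : Set (Fin 3 → ℝ)} {f : (Fin 3 → ℝ) → (Fin 3 → ℝ)} {lam : Fin 3 → (Fin 3 → ℝ) → ℝ}
  {om : Fin 3 → (Fin 3 → ℝ) → ((Fin 3 → ℝ) →L[ℝ] ℝ)}

theorem IsTSystem.reindex (hT : IsTSystem U f lam) (σ : Equiv.Perm (Fin 3)) :
    IsTSystem U f fun i => lam (σ i) where
  smooth_flux := hT.smooth_flux
  smooth_eigenvalue i := hT.smooth_eigenvalue (σ i)
  eigenvalue u hu i := hT.eigenvalue u hu (σ i)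
  distinct u hu _ _ hij := hT.distinct u hu _ _ (σ.injective.ne hij)
  straight i := hT.straight (σ i)
  linearly_degenerate i := hT.linearly_degenerate (σ i)

theorem IsTSystem.mono (hT : IsTSystem U f lam) {V : Set (Fin 3 → ℝ)} (hV : V ⊆ U) :
    IsTSystem V f lam where
  smooth_flux := hT.smooth_flux.mono hV
  smooth_eigenvalue i := (hT.smooth_eigenvalue i).mono hV
  eigenvalue u hu := hT.eigenvalue u (hV hu)
  distinct u hu := hT.distinct u (hV hu)
  straight i s t γ hγ := hT.straight i s t γ fun τ hτ => ⟨hV (hγ τ hτ).1, (hγ τ hτ).2⟩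
  linearly_degenerate i s t γ hγ :=
    hT.linearly_degenerate i s t γ fun τ hτ => ⟨hV (hγ τ hτ).1, (hγ τ hτ).2⟩

theorem IsEigenforms.renormalize (hom : IsEigenforms U f lam om) (σ : Equiv.Perm (Fin 3))
    {ρ : Fin 3 → (Fin 3 → ℝ) → ℝ} (hρ : IsNormalization U ρ) :
    IsEigenforms U f (fun i => lam (σ i)) (renormalize om σ ρ) := by
  intro i
  refine ⟨(hρ i).1.smul (hom (σ i)).1, fun u hu =>
    ⟨smul_ne_zero ((hρ i).2 u hu) ((hom (σ i)).2 u hu).1, ?_⟩⟩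
  simp only [_root_.renormalize]
  rw [ContinuousLinearMap.smul_comp, ((hom (σ i)).2 u hu).2, smul_comm]

theorem IsEigenforms.mono (hom : IsEigenforms U f lam om) {V : Set (Fin 3 → ℝ)} (hV : V ⊆ U) :
    IsEigenforms V f lam om :=
  fun i => ⟨(hom i).1.mono hV, fun u hu => (hom i).2 u (hV hu)⟩

end Reindex

section Eigenframe

variable {U : Set (Fin 3 → ℝ)} {f : (Fin 3 → ℝ) → (Fin 3 → ℝ)} {lam : Fin 3 → (Fin 3 → ℝ) → ℝ}
  {Ω : Fin 3 → (Fin 3 → ℝ) → ((Fin 3 → ℝ) →L[ℝ] ℝ)}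
  {X : Fin 3 → (Fin 3 → ℝ) → (Fin 3 → ℝ)} {u : Fin 3 → ℝ}

/-- Eigenforms for distinct eigenvalues are linearly independent: they have no common zero. -/
theorem IsEigenforms.eq_zero_of_forall (hT : IsTSystem U f lam) (hΩ : IsEigenforms U f lam Ω)
    (hu : u ∈ U) {w : Fin 3 → ℝ} (hw : ∀ i, Ω i u w = 0) : w = 0 := by
  choose ξ hξ using fun i => (hT.eigenvalue u hu i).exists_hasEigenvector
  have hinj : Function.Injective fun i => lam i u := fun i j hij => by
    by_contra hne
    exact hT.distinct u hu i j hne hij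
  have hli : LinearIndependent ℝ ξ :=
    Module.End.eigenvectors_linearIndependent' _ (fun i => lam i u) hinj ξ hξ
  let b := basisOfLinearIndependentOfCardEqFinrank hli (by simp)
  have hb : ∀ i, b i = ξ i := fun i => by simp [b]
  have hoff : ∀ i j, i ≠ j → Ω i u (ξ j) = 0 := by
    intro i j hij
    have h1 := congrArg (fun L : (Fin 3 → ℝ) →L[ℝ] ℝ => L (ξ j)) ((hΩ i).2 u hu).2
    have h2 : fderiv ℝ f u (ξ j) = lam j u • ξ j := (hξ j).apply_eq_smul
    simp only [ContinuousLinearMap.comp_apply, h2, map_smul, smul_eq_mul, smul_apply] at h1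
    have h3 : (lam j u - lam i u) * Ω i u (ξ j) = 0 := by linear_combination h1
    exact (mul_eq_zero.mp h3).resolve_left (sub_ne_zero.mpr (hT.distinct u hu j i hij.symm))
  have happly : ∀ i (w : Fin 3 → ℝ), Ω i u w = b.repr w i * Ω i u (ξ i) := by
    intro i w
    conv_lhs => rw [← b.sum_repr w]
    rw [map_sum, Finset.sum_eq_single i]
    · simp [hb]
    · intro j _ hj
      simp [hb, hoff i j hj.symm]
    · simp
  have hdiag : ∀ i, Ω i u (ξ i) ≠ 0 := by
    intro i h0
    apply ((hΩ i).2 u hu).1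
    ext1 w
    rw [happly, h0, mul_zero]
    rfl
  apply b.repr.injective
  ext i
  have := hw i
  rw [happly] at this
  simpa using (mul_eq_zero.mp this).resolve_right (hdiag i)

/-- The frame of right eigenvectors dual to the given eigenforms. -/
theorem IsEigenforms.exists_dualFrame (hU : IsOpen U) (hT : IsTSystem U f lam)
    (hΩ : IsEigenforms U f lam Ω) : ∃ X, IsDualFrame U Ω X := by
  let Φ : (Fin 3 → ℝ) → ((Fin 3 → ℝ) →L[ℝ] (Fin 3 → ℝ)) :=
    fun u => ∑ i, (Ω i u).smulRight (Pi.single i 1)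
  have hΦ : ∀ u w i, Φ u w i = Ω i u w := by
    intro u w i
    simp [Φ, Finset.sum_apply, Pi.single_apply]
  have hΦs : ContDiffOn ℝ ∞ Φ U :=
    ContDiffOn.sum fun i _ => (hΩ i).1.smulRight contDiffOn_const
  have hequiv : ∀ u ∈ U, ∃ e : (Fin 3 → ℝ) ≃L[ℝ] (Fin 3 → ℝ),
      (e : (Fin 3 → ℝ) →L[ℝ] (Fin 3 → ℝ)) = Φ u := by
    intro u hu
    have hinj : Function.Injective (Φ u : (Fin 3 → ℝ) →ₗ[ℝ] (Fin 3 → ℝ)) := by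
      rw [← LinearMap.ker_eq_bot, LinearMap.ker_eq_bot']
      intro w hw
      refine hΩ.eq_zero_of_forall hT hu fun i => ?_
      rw [← hΦ]
      exact congrFun hw i
    refine ⟨(LinearEquiv.ofInjectiveEndo _ hinj).toContinuousLinearEquiv, ?_⟩
    ext1 w
    simp
  refine ⟨fun j u => (Φ u).inverse (Pi.single j 1), hU, fun i => (hΩ i).1, fun j u hu => ?_,
    fun u hu i j => ?_⟩
  · obtain ⟨e, he⟩ := hequiv u hu
    have h1 : ContDiffAt ℝ ∞ ContinuousLinearMap.inverse (Φ u) := he ▸ contDiffAt_map_inverse e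
    have h2 := h1.comp_contDiffWithinAt u (hΦs u hu)
    exact h2.clm_apply contDiffWithinAt_const
  · obtain ⟨e, he⟩ := hequiv u hu
    rw [← hΦ, ← he, ContinuousLinearMap.inverse_equiv]
    simp [Pi.single_apply]

theorem IsDualFrame.fderiv_field_eq (h : IsDualFrame U Ω X) (hΩ : IsEigenforms U f lam Ω)
    (hu : u ∈ U) (j : Fin 3) : fderiv ℝ f u (X j u) = lam j u • X j u := by
  rw [← sub_eq_zero]
  apply h.eq_zero_of_forall_form hu
  intro i
  have h1 := congrArg (fun L : (Fin 3 → ℝ) →L[ℝ] ℝ => L (X j u)) ((hΩ i).2 u hu).2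
  simp only [ContinuousLinearMap.comp_apply, smul_apply] at h1
  rw [map_sub, h1, map_smul, h.dual u hu]
  by_cases hij : i = j
  · simp [hij]
  · simp [hij]

/-- The symmetry of `∇v = ∇df`, in components. -/
theorem IsDualFrame.codazzi_component (h : IsDualFrame U Ω X) (hT : IsTSystem U f lam)
    (hΩ : IsEigenforms U f lam Ω) (hu : u ∈ U) (i j k : Fin 3) :
    (frameDeriv X i (lam j) u * (if k = j then 1 else 0) + lam j u * christoffel Ω X k i j u) -
      (frameDeriv X j (lam i) u * (if k = i then 1 else 0) + lam i u * christoffel Ω X k j i u) =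
      lam k u * (christoffel Ω X k i j u - christoffel Ω X k j i u) := by
  have hc := frameDeriv_comm h.isOpen hT.smooth_flux h.smooth_field hu i j
  have key : ∀ a b, Ω k u (frameDeriv X a (frameDeriv X b f) u) =
      frameDeriv X a (lam b) u * (if k = b then 1 else 0) +
        lam b u * christoffel Ω X k a b u := by
    intro a b
    have he : frameDeriv X b f =ᶠ[nhds u] fun x => lam b x • X b x := by
      filter_upwards [h.isOpen.mem_nhds hu] with x hx using h.fderiv_field_eq hΩ hx b
    rw [frameDeriv, he.fderiv_eq, fderiv_fun_smul
      ((hT.smooth_eigenvalue b).differentiableAt_of_isOpen h.isOpen hu)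
      ((h.smooth_field b).differentiableAt_of_isOpen h.isOpen hu)]
    simp [h.dual u hu, christoffel, frameDeriv]
    ring
  have h1 := congrArg (Ω k u) hc
  have h2 := fun w => congrArg (fun L : (Fin 3 → ℝ) →L[ℝ] ℝ => L w) ((hΩ k).2 u hu).2
  simp only [ContinuousLinearMap.comp_apply, smul_apply] at h2
  rw [map_sub, key, key, h2, map_sub] at h1
  exact h1

/-- Through every point passes a rarefaction curve, an integral curve of the eigenfield. -/
theorem IsDualFrame.exists_rarefactionCurve (h : IsDualFrame U Ω X) (hΩ : IsEigenforms U f lam Ω)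
    (hu : u ∈ U) (i : Fin 3) : ∃ γ : ℝ → Fin 3 → ℝ, ∃ ε > 0, γ 0 = u ∧
      IsRarefactionCurve U f (lam i) (-ε) ε γ ∧
      ∀ t ∈ Set.Ioo (-ε) ε, HasDerivAt γ (X i (γ t)) t := by
  have hc : ContDiffAt ℝ 1 (X i) u :=
    ((h.smooth_field i).contDiffAt (h.isOpen.mem_nhds hu)).of_le (by exact_mod_cast le_top)
  obtain ⟨γ, h0, ε, hε, hγ⟩ :=
    hc.exists_forall_mem_closedBall_exists_eq_forall_mem_Ioo_hasDerivAt₀ 0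
  have hcont : ContinuousAt γ 0 := (hγ 0 (by simp [hε])).continuousAt
  have hmem : ∀ᶠ t in nhds 0, γ t ∈ U :=
    hcont.eventually (h0.symm ▸ h.isOpen.mem_nhds hu)
  obtain ⟨δ, hδ, hball⟩ := Metric.eventually_nhds_iff.mp hmem
  have hin : ∀ t ∈ Set.Ioo (-min ε δ) (min ε δ), γ t ∈ U ∧ HasDerivAt γ (X i (γ t)) t := by
    intro t ht
    have h1 := min_le_left ε δ
    have h2 := min_le_right ε δ
    refine ⟨hball ?_, hγ t ⟨by linarith [ht.1], by linarith [ht.2]⟩⟩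
    rw [Real.dist_eq, sub_zero, abs_lt]
    exact ⟨by linarith [ht.1], by linarith [ht.2]⟩
  refine ⟨γ, min ε δ, lt_min hε hδ, h0, fun t ht => ⟨(hin t ht).1, _, ?_, (hin t ht).2⟩,
    fun t ht => (hin t ht).2⟩
  refine Module.End.hasEigenvector_iff.mpr ⟨?_, fun hzero => ?_⟩
  · rw [Module.End.mem_eigenspace_iff]
    exact h.fderiv_field_eq hΩ (hin t ht).1 i
  · have := h.dual _ (hin t ht).1 i i
    rw [hzero] at this
    simp at this

/-- Since the rarefaction curves are straight, `∇_{X_i} X_i` is a multiple of `X_i`. -/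
theorem IsDualFrame.geodesic (h : IsDualFrame U Ω X) (hT : IsTSystem U f lam)
    (hΩ : IsEigenforms U f lam Ω) (hu : u ∈ U) {i k : Fin 3} (hki : k ≠ i) :
    christoffel Ω X k i i u = 0 := by
  obtain ⟨γ, ε, hε, h0, hγ, hd⟩ := h.exists_rarefactionCurve hΩ hu i
  have hmem0 : (0 : ℝ) ∈ Set.Ioo (-ε) ε := by simp [hε]
  obtain ⟨w, hw⟩ := (collinear_iff_of_mem (Set.mem_image_of_mem γ hmem0)).mp
    (hT.straight i _ _ γ hγ)
  have hd' : ∀ (L : (Fin 3 → ℝ) →L[ℝ] ℝ), ∀ t ∈ Set.Ioo (-ε) ε,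
      HasDerivAt (fun s => L (γ s - u)) (L (X i (γ t))) t := fun L t ht =>
    L.hasFDerivAt.comp_hasDerivAt t ((hd t ht).sub_const u)
  have hnhds : ∀ t ∈ Set.Ioo (-ε) ε, Set.Ioo (-ε) ε ∈ nhds t := fun t ht =>
    Ioo_mem_nhds ht.1 ht.2
  have hline : ∀ t ∈ Set.Ioo (-ε) ε, ∃ r : ℝ, γ t - u = r • w := by
    intro t ht
    obtain ⟨r, hr⟩ := hw (γ t) (Set.mem_image_of_mem γ ht)
    exact ⟨r, by rw [hr, h0]; simp⟩
  -- the direction of the line is annihilated by `Ω k u` since its tangent at `u` is `X i u`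
  have hkw : Ω k u w = 0 := by
    have e1 : HasDerivAt (fun s => Ω k u w * Ω i u (γ s - u)) (Ω k u w * 1) 0 := by
      have := (hd' (Ω i u) 0 hmem0).const_mul (Ω k u w)
      rwa [h0, h.dual u hu, if_pos rfl] at this
    have e2 : HasDerivAt (fun s => Ω i u w * Ω k u (γ s - u)) (Ω i u w * 0) 0 := by
      have := (hd' (Ω k u) 0 hmem0).const_mul (Ω i u w)
      rwa [h0, h.dual u hu, if_neg hki] at this
    have e3 : (fun s => Ω k u w * Ω i u (γ s - u)) =ᶠ[nhds 0]
        fun s => Ω i u w * Ω k u (γ s - u) := by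
      filter_upwards [hnhds 0 hmem0] with s hs
      obtain ⟨r, hr⟩ := hline s hs
      rw [hr, map_smul, map_smul, smul_eq_mul, smul_eq_mul]
      ring
    simpa using (e2.congr_of_eventuallyEq e3).unique e1 |>.symm
  have hzero : ∀ t ∈ Set.Ioo (-ε) ε, Ω k u (X i (γ t)) = 0 := by
    intro t ht
    have e3 : (fun s => Ω k u (γ s - u)) =ᶠ[nhds t] fun _ => (0 : ℝ) := by
      filter_upwards [hnhds t ht] with s hs
      obtain ⟨r, hr⟩ := hline s hs
      rw [hr, map_smul, hkw, smul_zero]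
    exact (hd' (Ω k u) t ht).unique ((hasDerivAt_const t (0 : ℝ)).congr_of_eventuallyEq e3)
  have hX : HasFDerivAt (X i) (fderiv ℝ (X i) u) (γ 0) := by
    rw [h0]
    exact ((h.smooth_field i).differentiableAt_of_isOpen h.isOpen hu).hasFDerivAt
  have hc : HasDerivAt (fun s => Ω k u (X i (γ s))) (Ω k u (fderiv ℝ (X i) u (X i (γ 0)))) 0 :=
    (Ω k u).hasFDerivAt.comp_hasDerivAt 0 (hX.comp_hasDerivAt 0 (hd 0 hmem0))
  have e4 : (fun s => Ω k u (X i (γ s))) =ᶠ[nhds 0] fun _ => (0 : ℝ) := by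
    filter_upwards [hnhds 0 hmem0] with s hs using hzero s hs
  have := hc.unique ((hasDerivAt_const 0 (0 : ℝ)).congr_of_eventuallyEq e4)
  rwa [h0] at this

theorem IsDualFrame.frameDeriv_eigenvalue_eq_zero (h : IsDualFrame U Ω X) (hT : IsTSystem U f lam)
    (hΩ : IsEigenforms U f lam Ω) (hu : u ∈ U) (i : Fin 3) : frameDeriv X i (lam i) u = 0 := by
  obtain ⟨γ, ε, hε, h0, hγ, hd⟩ := h.exists_rarefactionCurve hΩ hu i
  have hmem0 : (0 : ℝ) ∈ Set.Ioo (-ε) ε := by simp [hε]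
  have hl : HasFDerivAt (lam i) (fderiv ℝ (lam i) u) (γ 0) := by
    rw [h0]
    exact ((hT.smooth_eigenvalue i).differentiableAt_of_isOpen h.isOpen hu).hasFDerivAt
  have hc : HasDerivAt (fun s => lam i (γ s)) (fderiv ℝ (lam i) u (X i (γ 0))) 0 :=
    hl.comp_hasDerivAt 0 (hd 0 hmem0)
  have e4 : (fun s => lam i (γ s)) =ᶠ[nhds 0] fun _ => lam i (γ 0) := by
    filter_upwards [Ioo_mem_nhds hmem0.1 hmem0.2] with s hs
    exact hT.linearly_degenerate i _ _ γ hγ s hs 0 hmem0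
  have := hc.unique ((hasDerivAt_const 0 _).congr_of_eventuallyEq e4)
  rwa [h0] at this

theorem IsDualFrame.isTFrame (h : IsDualFrame U Ω X) (hT : IsTSystem U f lam)
    (hΩ : IsEigenforms U f lam Ω) : IsTFrame U lam Ω X where
  toIsDualFrame := h
  smooth_eigenvalue := hT.smooth_eigenvalue
  distinct := hT.distinct
  codazzi u hu i j k _ hjk hik := by
    have := h.codazzi_component hT hΩ hu i j k
    rw [if_neg hjk.symm, if_neg hik.symm] at this
    linear_combination this
  codazzi_self u hu i j hij := by
    have := h.codazzi_component hT hΩ hu i j j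
    rw [if_pos rfl, if_neg hij.symm] at this
    linear_combination this
  geodesic u hu i k hki := h.geodesic hT hΩ hu hki
  linearly_degenerate u hu i := h.frameDeriv_eigenvalue_eq_zero hT hΩ hu i

end Eigenframe

/-! ### Consequences of the structure equations -/

/-- The structure coefficients `c^k_{ij}` with distinct indices of a frame whose dual coframe
satisfies `dω^k = e k ω^{k+1} ∧ ω^{k+2}` modulo `ω^k` (indices modulo 3). -/
def cyclicCoeff (e : Fin 3 → ℝ) (k i j : Fin 3) : ℝ :=
  if j = i + 1 then -e k else e k

section

variable {U : Set (Fin 3 → ℝ)} {lam : Fin 3 → (Fin 3 → ℝ) → ℝ}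
  {Ω : Fin 3 → (Fin 3 → ℝ) → ((Fin 3 → ℝ) →L[ℝ] ℝ)}
  {X : Fin 3 → (Fin 3 → ℝ) → (Fin 3 → ℝ)} {e : Fin 3 → ℝ} {u : Fin 3 → ℝ}

theorem cyclicCoeff_antisymm (e : Fin 3 → ℝ) {i j : Fin 3} (k : Fin 3) (hij : i ≠ j) :
    cyclicCoeff e k j i = -cyclicCoeff e k i j := by
  fin_cases i <;> fin_cases j <;> first | exact absurd rfl hij | simp [cyclicCoeff]

theorem Fin.cyclic_or_anticyclic {i j k : Fin 3} (hij : i ≠ j) (hjk : j ≠ k) (hik : i ≠ k) :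
    (i = k + 1 ∧ j = k + 2) ∨ (j = k + 1 ∧ i = k + 2) := by
  revert i j k
  decide

theorem cyclicCoeff_succ (e : Fin 3 → ℝ) (k : Fin 3) : cyclicCoeff e k (k + 1) (k + 2) = -e k := by
  fin_cases k <;> simp [cyclicCoeff]

theorem IsTFrame.isConstTFrame (h : IsTFrame U lam Ω X) (he : ∀ k, e k ≠ 0)
    (hc : ∀ u ∈ U, ∀ k, structCoeff Ω X k (k + 1) (k + 2) u = -e k) :
    IsConstTFrame U lam Ω X (cyclicCoeff e) where
  toIsTFrame := h
  const_ne_zero i j k _ _ _ := by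
    rw [cyclicCoeff]
    split_ifs
    · exact neg_ne_zero.mpr (he k)
    · exact he k
  const_antisymm i j k hij := cyclicCoeff_antisymm e k hij
  structCoeff_eq u hu i j k hij hjk hik := by
    rcases Fin.cyclic_or_anticyclic hij hjk hik with ⟨rfl, rfl⟩ | ⟨rfl, rfl⟩
    · rw [hc u hu, cyclicCoeff_succ]
    · rw [structCoeff_antisymm, hc u hu, cyclicCoeff_antisymm e k hij.symm, cyclicCoeff_succ]

theorem IsConstTFrame.secondDerivativeFormulas (h : IsConstTFrame U lam Ω X (cyclicCoeff e))
    (hu : u ∈ U) : SecondDerivativeFormulas e (fun i => lam i u)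
      (fun i j => frameDeriv X j (lam i) u)
      (fun i j k => frameDeriv X k (frameDeriv X j (lam i)) u) where
  diag i := h.linearly_degenerate u hu i
  diag_deriv i j := IsTFrame.frameDeriv_eq_zero_of_eqOn h.isOpen
    (fun x hx => h.linearly_degenerate x hx i) hu j
  mixed_succ i := by
    have h1 : i ≠ i + 1 := by revert i; decide
    have h2 : i + 1 ≠ i + 2 := by revert i; decide
    have h3 : i ≠ i + 2 := by revert i; decide
    rw [h.second_deriv_mixed h1 h2 h3 hu, h.structCoeff_eq_zero h1 hu, cyclicCoeff, if_pos rfl]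
    ring
  mixed_pred i := by
    have h1 : i ≠ i + 1 := by revert i; decide
    have h2 : i + 1 ≠ i + 2 := by revert i; decide
    have h3 : i ≠ i + 2 := by revert i; decide
    have h4 : ¬ (i + 2 = i + 1) := by revert i; decide
    rw [h.second_deriv_mixed h3 h2.symm h1 hu, h.structCoeff_eq_zero h3 hu, cyclicCoeff, if_neg h4]
    ring
  off i j k hj hk := by
    have h1 : j ≠ k := by subst hj hk; revert i; decide
    have h2 : k ≠ i := hk ▸ (by decide : ∀ i : Fin 3, i + 2 ≠ i) i
    have h3 : j ≠ i := hj ▸ (by decide : ∀ i : Fin 3, i + 1 ≠ i) i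
    have h4 : k = j + 1 := by subst hj hk; revert i; decide
    constructor
    · rw [h.second_deriv_distinct h1 h2 h3 hu, cyclicCoeff, if_pos h4]
      ring
    · rw [h.second_deriv_comm h1 h2 h3 hu, h.structCoeff_eq_zero h1 hu,
        h.structCoeff_eq_zero h1.symm hu]
      ring
  second i j k hij hjk hki := by
    rw [h.second_deriv_twice hij.symm hki.symm hjk hu]
    have : cyclicCoeff e i k j * cyclicCoeff e k j i = e i * e k := by
      rcases Fin.cyclic_or_anticyclic hij hjk hki.symm with ⟨rfl, rfl⟩ | ⟨rfl, rfl⟩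
      · rw [cyclicCoeff, cyclicCoeff, if_neg, if_neg] <;> (try revert k) <;> decide
      · rw [cyclicCoeff, cyclicCoeff, if_pos, if_pos]
        · ring
        · revert k; decide
        · revert k; decide
    rw [this]

theorem IsTFrame.isCoframeDeriv (h : IsTFrame U lam Ω X) {g : (Fin 3 → ℝ) → ℝ}
    (hg : ContDiffOn ℝ ∞ g U) : IsCoframeDeriv U Ω g fun j => frameDeriv X j g := by
  intro u hu
  rw [← h.fderiv_eq_sum hu]
  exact (hg.differentiableAt_of_isOpen h.isOpen hu).hasFDerivAt

/-- The structure equations with remaining coefficients, for a T-system: these coefficients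
vanish, and the second derivatives of the eigenvalues are determined. -/
theorem StructureEquationsWith.rigidity {f : (Fin 3 → ℝ) → (Fin 3 → ℝ)} (hU : IsOpen U)
    (hT : IsTSystem U f lam) (hΩ : IsEigenforms U f lam Ω) {ε : ℝ} (hε : ε = 1 ∨ ε = -1)
    {a b p q r s : (Fin 3 → ℝ) → ℝ} (hS : StructureEquationsWith U ε a b p q r s Ω) :
    (∀ u ∈ U, a u = 0 ∧ b u = 0 ∧ p u = 0 ∧ q u = 0 ∧ r u = 0 ∧ s u = 0) ∧
      ∃ (l : Fin 3 → Fin 3 → (Fin 3 → ℝ) → ℝ) (m : Fin 3 → Fin 3 → Fin 3 → (Fin 3 → ℝ) → ℝ),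
        (∀ i, IsCoframeDeriv U Ω (lam i) (l i)) ∧
        (∀ i j, IsCoframeDeriv U Ω (l i j) (m i j)) ∧
        ∀ u ∈ U, SecondDerivativeFormulas ![1, ε, 1] (fun i => lam i u)
          (fun i j => l i j u) (fun i j k => m i j k u) := by
  obtain ⟨X, hX⟩ := hΩ.exists_dualFrame hU hT
  have hF := hX.isTFrame hT hΩ
  have hd : ∀ u ∈ U, ∀ k i j, dForm (Ω k) u (X i u) (X j u) = -structCoeff Ω X k i j u := by
    intro u hu k i j
    rw [hX.dForm_eq_structCoeff hu]
    fin_cases i <;> fin_cases j <;> simp [wedge, hX.dual u hu, structCoeff]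
  have hC : IsConstTFrame U lam Ω X (cyclicCoeff ![1, ε, 1]) := by
    refine hF.isConstTFrame (fun k => ?_) fun u hu k => ?_
    · rcases hε with rfl | rfl <;> fin_cases k <;> simp
    · have h0 := (hS u hu (X 1 u) (X 2 u)).1
      have h1 := (hS u hu (X 2 u) (X 0 u)).2.1
      have h2 := (hS u hu (X 0 u) (X 1 u)).2.2
      rw [hd u hu] at h0 h1 h2
      simp [wedge, hX.dual u hu] at h0 h1 h2
      fin_cases k
      · simpa using (neg_eq_iff_eq_neg.mp h0)
      · simpa using (neg_eq_iff_eq_neg.mp h1)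
      · simpa using (neg_eq_iff_eq_neg.mp h2)
  refine ⟨fun u hu => ?_, fun i j => frameDeriv X j (lam i),
    fun i j k => frameDeriv X k (frameDeriv X j (lam i)),
    fun i => hF.isCoframeDeriv (hF.smooth_eigenvalue i),
    fun i j => hF.isCoframeDeriv (hF.smooth_frameDeriv i j),
    fun u hu => hC.secondDerivativeFormulas hu⟩
  have hz : ∀ i j, i ≠ j → structCoeff Ω X j j i u = 0 := fun i j hij => by
    rw [IsTFrame.structCoeff_antisymm, hC.structCoeff_eq_zero hij hu, neg_zero]
  have ha := (hS u hu (X 0 u) (X 1 u)).1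
  have hb := (hS u hu (X 0 u) (X 2 u)).1
  have hp := (hS u hu (X 1 u) (X 0 u)).2.1
  have hq := (hS u hu (X 1 u) (X 2 u)).2.1
  have hr := (hS u hu (X 2 u) (X 0 u)).2.2
  have hs := (hS u hu (X 2 u) (X 1 u)).2.2
  rw [hd u hu, hz _ _ (by decide)] at ha hb hp hq hr hs
  simp [wedge, hX.dual u hu] at ha hb hp hq hr hs
  exact ⟨ha.symm, hb.symm, hp.symm, hq.symm, hr.symm, hs.symm⟩

end

/-! ### Riemann invariants from vanishing structure coefficients -/

section

variable {U V : Set (Fin 3 → ℝ)} {f : (Fin 3 → ℝ) → (Fin 3 → ℝ)}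
  {lam : Fin 3 → (Fin 3 → ℝ) → ℝ} {Ω : Fin 3 → (Fin 3 → ℝ) → ((Fin 3 → ℝ) →L[ℝ] ℝ)}
  {X : Fin 3 → (Fin 3 → ℝ) → (Fin 3 → ℝ)} {u : Fin 3 → ℝ} {i j k : Fin 3}

theorem IsDualFrame.mono (h : IsDualFrame U Ω X) (hV : IsOpen V) (hVU : V ⊆ U) :
    IsDualFrame V Ω X :=
  ⟨hV, fun i => (h.smooth_form i).mono hVU, fun i => (h.smooth_field i).mono hVU,
    fun u hu => h.dual u (hVU hu)⟩

/-- If `c^k_{ij}` vanishes then, for a T-system, the planes `ker Ω k` are autoparallel. Hence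
their integral surfaces are planes. Let `η` be the multiple of `Ω k` that takes the value one on a
fixed vector `e`. Then `η` is constant along these planes, and `R u = η u (u - u₀)`, the parameter
of the intersection of the plane through `u` with the line `u₀ + ℝ e`, is a Riemann invariant. -/
theorem IsTFrame.exists_riemannInvariant (h : IsTFrame V lam Ω X) (hΩ : IsEigenforms V f lam Ω)
    (hV : V.Nonempty) (hij : i ≠ j) (hjk : j ≠ k) (hik : i ≠ k)
    (hc : ∀ u ∈ V, structCoeff Ω X k i j u = 0) :
    ∃ W ⊆ V, IsOpen W ∧ W.Nonempty ∧ ∃ R, IsRiemannInvariant W f (lam k) R := by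
  obtain ⟨u₀, hu₀⟩ := hV
  have hpar : ∀ u ∈ V, ∀ a b, a ≠ k → b ≠ k → christoffel Ω X k a b u = 0 := by
    have key : ∀ a : Fin 3, a ≠ k → a = i ∨ a = j := by
      clear hc
      revert i j k
      decide
    intro u hu a b ha hb
    have e1 : christoffel Ω X k i j u = 0 := by
      rw [h.christoffel_distinct hu hij hjk hik, hc u hu, mul_zero]
    have e2 : christoffel Ω X k j i u = 0 := by
      rw [h.christoffel_distinct hu hij.symm hik hjk, structCoeff_antisymm, hc u hu, neg_zero,
        mul_zero]
    rcases key a ha with rfl | rfl <;> rcases key b hb with rfl | rfl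
    · exact h.geodesic u hu _ _ hik.symm
    · exact e1
    · exact e2
    · exact h.geodesic u hu _ _ hjk.symm
  set e := X k u₀ with he
  set W := {u ∈ V | Ω k u e ≠ 0} with hW
  have hWV : W ⊆ V := fun u hu => hu.1
  have hcont : ContinuousOn (fun u => Ω k u e) V :=
    ((h.smooth_form k).clm_apply contDiffOn_const).continuousOn
  have hWo : IsOpen W := hcont.isOpen_inter_preimage h.isOpen isOpen_ne
  have hu₀W : u₀ ∈ W := ⟨hu₀, by rw [he, h.dual u₀ hu₀]; simp⟩
  set η : (Fin 3 → ℝ) → ((Fin 3 → ℝ) →L[ℝ] ℝ) := fun u => (Ω k u e)⁻¹ • Ω k u with hη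
  have hηs : ContDiffOn ℝ ∞ η W := by
    have h1 : ContDiffOn ℝ ∞ (fun u => Ω k u e) W :=
      ((h.smooth_form k).mono hWV).clm_apply contDiffOn_const
    exact (h1.inv fun u hu => hu.2).smul ((h.smooth_form k).mono hWV)
  have hηd : ∀ u ∈ W, DifferentiableAt ℝ η u := fun u hu =>
    hηs.differentiableAt_of_isOpen hWo hu
  have hηe : ∀ u ∈ W, η u e = 1 := fun u hu => by
    simp [hη, inv_mul_cancel₀ hu.2]
  have hηX : ∀ u ∈ W, ∀ b, b ≠ k → η u (X b u) = 0 := fun u hu b hb => by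
    simp [hη, h.dual u hu.1, hb.symm]
  have hηpar : ∀ u ∈ W, ∀ a, a ≠ k → fderiv ℝ η u (X a u) = 0 := by
    intro u hu a ha
    have h1 : ∀ b, b ≠ k → fderiv ℝ η u (X a u) (X b u) = 0 := by
      intro b hb
      have h2 : (fun x => η x (X b x)) =ᶠ[nhds u] fun _ => (0 : ℝ) := by
        filter_upwards [hWo.mem_nhds hu] with x hx using hηX x hx b hb
      have h3 := congrArg (fun L : (Fin 3 → ℝ) →L[ℝ] ℝ => L (X a u)) h2.fderiv_eq
      simp only [fderiv_fun_const] at h3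
      rw [fderiv_clm_apply (hηd u hu)
        ((h.smooth_field b).differentiableAt_of_isOpen h.isOpen hu.1)] at h3
      have h4 : η u (fderiv ℝ (X b) u (X a u)) = 0 := by
        have : Ω k u (fderiv ℝ (X b) u (X a u)) = 0 := hpar u hu.1 a b ha hb
        simp [hη, this]
      simpa [h4] using h3
    have h5 : fderiv ℝ η u (X a u) e = 0 := by
      have h2 : (fun x => η x e) =ᶠ[nhds u] fun _ => (1 : ℝ) := by
        filter_upwards [hWo.mem_nhds hu] with x hx using hηe x hx
      have h3 := congrArg (fun L : (Fin 3 → ℝ) →L[ℝ] ℝ => L (X a u)) h2.fderiv_eq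
      simp only [fderiv_fun_const] at h3
      rw [fderiv_clm_apply (hηd u hu) (differentiableAt_const e)] at h3
      simpa using h3
    have h6 : fderiv ℝ η u (X a u) (X k u) = 0 := by
      rw [h.expand hu.1 e, Fin.sum_three_of_ne hij hjk hik] at h5
      simp only [map_add, map_smul, h1 i hik, h1 j hjk, smul_eq_mul, mul_zero, zero_add] at h5
      exact (mul_eq_zero.mp h5).resolve_left hu.2
    ext1 w
    rw [h.expand hu.1 w, map_sum]
    simp only [map_smul, zero_apply]
    refine Finset.sum_eq_zero fun b _ => ?_
    by_cases hb : b = k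
    · rw [hb, h6, smul_zero]
    · rw [h1 b hb, smul_zero]
  set R : (Fin 3 → ℝ) → ℝ := fun u => η u (u - u₀) with hR
  have hRs : ContDiffOn ℝ ∞ R W := hηs.clm_apply (contDiffOn_id.sub contDiffOn_const)
  have hdR : ∀ u ∈ W, ∀ w, fderiv ℝ R u w = fderiv ℝ η u w (u - u₀) + η u w := by
    intro u hu w
    have hid : DifferentiableAt ℝ (fun x : Fin 3 → ℝ => x - u₀) u := by fun_prop
    rw [hR, fderiv_clm_apply (hηd u hu) hid]
    simp [fderiv_sub_const, add_comm]
  have hdRX : ∀ u ∈ W, ∀ a, a ≠ k → fderiv ℝ R u (X a u) = 0 := by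
    intro u hu a ha
    rw [hdR u hu, hηpar u hu a ha, hηX u hu a ha]
    simp
  set W' := {u ∈ W | fderiv ℝ R u ≠ 0} with hW'
  have hW'o : IsOpen W' :=
    (contDiffOn_fderiv_of_isOpen hRs hWo).continuousOn.isOpen_inter_preimage hWo isOpen_ne
  refine ⟨W', fun u hu => hu.1.1, hW'o, ⟨u₀, hu₀W, fun h0 => ?_⟩, R,
    hRs.mono fun u hu => hu.1, fun u hu => ⟨hu.2, ?_⟩⟩
  · have := hdR u₀ hu₀W e
    rw [h0, hηe u₀ hu₀W] at this
    simp at this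
  · ext1 w
    rw [h.expand hu.1.1 w, map_sum, map_sum]
    refine Finset.sum_congr rfl fun a _ => ?_
    simp only [map_smul, ContinuousLinearMap.comp_apply, smul_apply,
      h.fderiv_field_eq hΩ hu.1.1 a]
    by_cases ha : a = k
    · rw [ha]
    · simp only [hdRX u hu.1 a ha, smul_zero]

end

/-! ### Propagation of zeros -/

/-- A solution `g` of a linear equation `dg = g B` with a continuous one-form `B` that vanishes at
one point vanishes near this point, by Gronwall's inequality along line segments. -/
theorem eventually_eq_zero_of_fderiv_eq_smul {E : Type*} [NormedAddCommGroup E] [NormedSpace ℝ E]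
    {U : Set E} (hU : IsOpen U) {g : E → ℝ} {B : E → (E →L[ℝ] ℝ)}
    (hg : ∀ u ∈ U, HasFDerivAt g (g u • B u) u) (hB : ContinuousOn B U) {x : E} (hx : x ∈ U)
    (h0 : g x = 0) : ∀ᶠ y in nhds x, g y = 0 := by
  have hBx : ContinuousAt B x := hB.continuousAt (hU.mem_nhds hx)
  have hxU : ∀ᶠ y in nhds x, y ∈ U := hU.mem_nhds hx
  have hev : ∀ᶠ y in nhds x, y ∈ U ∧ ‖B y‖ < ‖B x‖ + 1 :=
    hxU.and (hBx.norm.eventually (gt_mem_nhds (lt_add_one _)))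
  obtain ⟨r, hr, hball⟩ := Metric.eventually_nhds_iff_ball.mp hev
  refine Metric.eventually_nhds_iff_ball.mpr ⟨r, hr, fun y hy => ?_⟩
  have hseg : ∀ t ∈ Set.Icc (0 : ℝ) 1, x + t • (y - x) ∈ Metric.ball x r := by
    intro t ht
    rw [mem_ball_iff_norm] at hy ⊢
    rw [add_sub_cancel_left, norm_smul, Real.norm_of_nonneg ht.1]
    calc t * ‖y - x‖ ≤ 1 * ‖y - x‖ := by gcongr; exact ht.2
      _ < r := by rwa [one_mul]
  have hder : ∀ t ∈ Set.Icc (0 : ℝ) 1, HasDerivAt (fun t : ℝ => g (x + t • (y - x)))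
      (g (x + t • (y - x)) * B (x + t • (y - x)) (y - x)) t := by
    intro t ht
    have hl : HasDerivAt (fun t : ℝ => x + t • (y - x)) (y - x) t := by
      simpa using ((hasDerivAt_id t).smul_const (y - x)).const_add x
    exact ((hg _ (hball _ (hseg t ht)).1).comp_hasDerivAt t hl).congr_deriv (by simp)
  have hgr := norm_le_gronwallBound_of_norm_deriv_right_le (δ := 0) (ε := 0)
    (K := (‖B x‖ + 1) * ‖y - x‖) (f := fun t : ℝ => g (x + t • (y - x)))
    (fun t ht => (hder t ht).continuousAt.continuousWithinAt)
    (fun t ht => (hder t (Set.Ico_subset_Icc_self ht)).hasDerivWithinAt) (by simp [h0])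
    (fun t ht => by
      rw [norm_mul, add_zero, mul_comm]
      gcongr
      refine (ContinuousLinearMap.le_opNorm _ _).trans ?_
      gcongr
      exact (hball _ (hseg t (Set.Ico_subset_Icc_self ht))).2.le) 1 (by simp)
  simpa [gronwallBound_ε0_δ0] using hgr

theorem eq_zero_of_fderiv_eq_smul {E : Type*} [NormedAddCommGroup E] [NormedSpace ℝ E]
    {U : Set E} (hU : IsOpen U) (hconn : IsPreconnected U) {g : E → ℝ} {B : E → (E →L[ℝ] ℝ)}
    (hg : ∀ u ∈ U, HasFDerivAt g (g u • B u) u) (hB : ContinuousOn B U) {x : E} (hx : x ∈ U)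
    (h0 : g x = 0) : ∀ u ∈ U, g u = 0 := by
  have hsub : U ⊆ {y | ∀ᶠ z in nhds y, g z = 0} := by
    refine hconn.subset_of_closure_inter_subset isOpen_setOfPred_eventually_nhds
      ⟨x, hx, eventually_eq_zero_of_fderiv_eq_smul hU hg hB hx h0⟩ ?_
    rintro y ⟨hy, hyU⟩
    refine eventually_eq_zero_of_fderiv_eq_smul hU hg hB hyU ?_
    by_contra hne
    have hev : ∀ᶠ z in nhds y, g z ≠ 0 := (hg y hyU).continuousAt.eventually_ne hne
    obtain ⟨z, hz1, hz2⟩ := mem_closure_iff_nhds.mp hy _ hev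
    exact hz1 hz2.self_of_nhds
  exact fun u hu => (hsub hu).self_of_nhds

/-! ### Change of normalization -/

section Rescale

variable {U : Set (Fin 3 → ℝ)} {lam : Fin 3 → (Fin 3 → ℝ) → ℝ}
  {Ω : Fin 3 → (Fin 3 → ℝ) → ((Fin 3 → ℝ) →L[ℝ] ℝ)}
  {X : Fin 3 → (Fin 3 → ℝ) → (Fin 3 → ℝ)} {ρ : Fin 3 → (Fin 3 → ℝ) → ℝ} {u : Fin 3 → ℝ}

/-- The coframe `ρ i • Ω i`. -/
def rescaleForm (ρ : Fin 3 → (Fin 3 → ℝ) → ℝ)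
    (Ω : Fin 3 → (Fin 3 → ℝ) → ((Fin 3 → ℝ) →L[ℝ] ℝ)) :
    Fin 3 → (Fin 3 → ℝ) → ((Fin 3 → ℝ) →L[ℝ] ℝ) :=
  fun i u => ρ i u • Ω i u

/-- The frame `(ρ i)⁻¹ • X i`, dual to `rescaleForm ρ Ω` when `X` is dual to `Ω`. -/
noncomputable def rescaleField (ρ : Fin 3 → (Fin 3 → ℝ) → ℝ)
    (X : Fin 3 → (Fin 3 → ℝ) → (Fin 3 → ℝ)) : Fin 3 → (Fin 3 → ℝ) → (Fin 3 → ℝ) :=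
  fun i u => (ρ i u)⁻¹ • X i u

theorem IsDualFrame.rescale (h : IsDualFrame U Ω X) (hρ : IsNormalization U ρ) :
    IsDualFrame U (rescaleForm ρ Ω) (rescaleField ρ X) where
  isOpen := h.isOpen
  smooth_form i := (hρ i).1.smul (h.smooth_form i)
  smooth_field i := ((hρ i).1.inv (hρ i).2).smul (h.smooth_field i)
  dual u hu i j := by
    simp only [rescaleForm, rescaleField, smul_apply, map_smul, h.dual u hu, smul_eq_mul]
    by_cases hij : i = j
    · subst hij
      simp [(hρ i).2 u hu]
    · simp [hij]

theorem frameDeriv_rescaleField (i : Fin 3) (g : (Fin 3 → ℝ) → ℝ) :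
    frameDeriv (rescaleField ρ X) i g u = (ρ i u)⁻¹ * frameDeriv X i g u := by
  simp [frameDeriv, rescaleField]

theorem IsDualFrame.christoffel_rescale (h : IsDualFrame U Ω X) (hρ : IsNormalization U ρ)
    (hu : u ∈ U) (k i j : Fin 3) :
    christoffel (rescaleForm ρ Ω) (rescaleField ρ X) k i j u =
      ρ k u / (ρ i u * ρ j u) * christoffel Ω X k i j u -
        (if k = j then frameDeriv X i (ρ j) u / (ρ i u * ρ j u) else 0) := by
  have hi := (hρ i).2 u hu
  have hj := (hρ j).2 u hu
  have hinv : HasFrameDeriv X (fun x => (ρ j x)⁻¹)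
      (fun a => -frameDeriv X a (ρ j) u / ρ j u ^ 2) u :=
    (HasFrameDeriv.of_contDiffOn h.isOpen (hρ j).1 hu).inv hj
  have hd : frameDeriv (rescaleField ρ X) i (rescaleField ρ X j) u =
      (ρ i u)⁻¹ • ((ρ j u)⁻¹ • frameDeriv X i (X j) u +
        (-frameDeriv X i (ρ j) u / ρ j u ^ 2) • X j u) := by
    have hinv2 := hinv.2 i
    dsimp only at hinv2
    rw [← hinv2]
    have : rescaleField ρ X j = fun x => (ρ j x)⁻¹ • X j x := rfl
    rw [frameDeriv, this, fderiv_fun_smul hinv.1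
      ((h.smooth_field j).differentiableAt_of_isOpen h.isOpen hu)]
    simp [frameDeriv, rescaleField]
  rw [christoffel, hd]
  simp only [rescaleForm, smul_apply, map_smul, map_add, h.dual u hu, smul_eq_mul, christoffel]
  by_cases hkj : k = j
  · subst hkj
    simp only [if_true]
    field_simp
    ring
  · simp only [if_neg hkj]
    field_simp
    ring

theorem IsDualFrame.structCoeff_rescale_distinct (h : IsDualFrame U Ω X)
    (hρ : IsNormalization U ρ) (hu : u ∈ U) {i j k : Fin 3} (hjk : j ≠ k) (hik : i ≠ k) :
    structCoeff (rescaleForm ρ Ω) (rescaleField ρ X) k i j u =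
      ρ k u / (ρ i u * ρ j u) * structCoeff Ω X k i j u := by
  rw [structCoeff, h.christoffel_rescale hρ hu, h.christoffel_rescale hρ hu, if_neg hjk.symm,
    if_neg hik.symm, structCoeff, mul_comm (ρ j u)]
  ring

/-- Nonvanishing structure coefficients `c^k_{k+1,k+2}`, with signs `s k`, can be normalized to
`s k * t` for either sign `t`, by the factors `ρ k = t |c^{k+1} c^{k+2}|^{1/2}`. -/
theorem IsDualFrame.exists_normalization (h : IsDualFrame U Ω X) {s : Fin 3 → ℝ} {t : ℝ}
    (hs : ∀ k, s k * s k = 1) (ht : t * t = 1)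
    (hc : ∀ u ∈ U, ∀ k, 0 < s k * structCoeff Ω X k (k + 1) (k + 2) u) :
    ∃ ρ, IsNormalization U ρ ∧ (∀ u ∈ U, ∀ k, structCoeff Ω X k (k + 1) (k + 2) u =
        s k * t * (ρ (k + 1) u * ρ (k + 2) u / ρ k u)) ∧
      ∀ u ∈ U, ∀ k, structCoeff (rescaleForm ρ Ω) (rescaleField ρ X) k (k + 1) (k + 2) u =
        s k * t := by
  set C : Fin 3 → (Fin 3 → ℝ) → ℝ := fun k => structCoeff Ω X k (k + 1) (k + 2) with hC
  set r : Fin 3 → (Fin 3 → ℝ) → ℝ := fun k u => Real.sqrt (s k * C k u) with hr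
  have ht0 : t ≠ 0 := fun h0 => by simp [h0] at ht
  have hr0 : ∀ u ∈ U, ∀ k, r k u ≠ 0 := fun u hu k => (Real.sqrt_pos.mpr (hc u hu k)).ne'
  have hrs : ∀ k, ContDiffOn ℝ ∞ (r k) U := fun k =>
    (contDiffOn_const.mul (h.contDiffOn_structCoeff k (k + 1) (k + 2))).sqrt
      fun u hu => (hc u hu k).ne'
  have hrC : ∀ u ∈ U, ∀ k, C k u = s k * (r k u * r k u) := by
    intro u hu k
    rw [hr, Real.mul_self_sqrt (hc u hu k).le, ← mul_assoc, hs, one_mul]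
  have hρ : IsNormalization U fun k u => t * (r (k + 1) u * r (k + 2) u) := fun k =>
    ⟨contDiffOn_const.mul ((hrs _).mul (hrs _)), fun u hu =>
      mul_ne_zero ht0 (mul_ne_zero (hr0 u hu _) (hr0 u hu _))⟩
  have e1 : ∀ k : Fin 3, k + 1 + 1 = k + 2 := by decide
  have e2 : ∀ k : Fin 3, k + 1 + 2 = k := by decide
  have e3 : ∀ k : Fin 3, k + 2 + 1 = k := by decide
  have e4 : ∀ k : Fin 3, k + 2 + 2 = k + 1 := by decide
  have e5 : ∀ k : Fin 3, k + 2 ≠ k := by decide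
  have e6 : ∀ k : Fin 3, k + 1 ≠ k := by decide
  have key : ∀ u ∈ U, ∀ k, C k u = s k * t * ((t * (r (k + 1 + 1) u * r (k + 1 + 2) u)) *
      (t * (r (k + 2 + 1) u * r (k + 2 + 2) u)) / (t * (r (k + 1) u * r (k + 2) u))) := by
    intro u hu k
    rw [e1, e2, e3, e4, hrC u hu k]
    have h1 := hr0 u hu (k + 1)
    have h2 := hr0 u hu (k + 2)
    field_simp
    linear_combination (-(s k) * r k u ^ 2) * ht
  refine ⟨_, hρ, key, fun u hu k => ?_⟩
  rw [h.structCoeff_rescale_distinct hρ hu (e5 k) (e6 k)]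
  have hk := key u hu k
  have h1 := (hρ k).2 u hu
  have h2 := (hρ (k + 1)).2 u hu
  have h3 := (hρ (k + 2)).2 u hu
  simp only [hC] at hk
  dsimp only at h1 h2 h3 ⊢
  rw [hk]
  generalize t * (r (k + 1 + 1) u * r (k + 1 + 2) u) = A at *
  generalize t * (r (k + 2 + 1) u * r (k + 2 + 2) u) = B at *
  generalize t * (r (k + 1) u * r (k + 2) u) = D at *
  field_simp

/-- The coefficient `A i j` of the equations `X_i(ρ j) = ρ j * A i j` for the factors `ρ` that
normalize the coframe. It is a smooth function also where there are no such factors. -/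
noncomputable def normalizerLogDeriv (lam : Fin 3 → (Fin 3 → ℝ) → ℝ)
    (Ω : Fin 3 → (Fin 3 → ℝ) → ((Fin 3 → ℝ) →L[ℝ] ℝ))
    (X : Fin 3 → (Fin 3 → ℝ) → (Fin 3 → ℝ)) (i j : Fin 3) (u : Fin 3 → ℝ) : ℝ :=
  if i = j then
    christoffel Ω X i i i u -
      (2 * frameDeriv X i (lam (i + 1)) u *
          (1 / (lam i u - lam (i + 1) u) + 1 / (lam (i + 1) u - lam (i + 2) u)) +
        2 * frameDeriv X i (lam (i + 2)) u *
          (1 / (lam i u - lam (i + 2) u) + 1 / (lam (i + 2) u - lam (i + 1) u)))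
  else structCoeff Ω X j i j u

theorem IsTFrame.continuousOn_normalizerLogDeriv (h : IsTFrame U lam Ω X) (i j : Fin 3) :
    ContinuousOn (normalizerLogDeriv lam Ω X i j) U := by
  have e1 : ∀ i : Fin 3, i ≠ i + 1 := by decide
  have e2 : ∀ i : Fin 3, i + 1 ≠ i + 2 := by decide
  have e3 : ∀ i : Fin 3, i ≠ i + 2 := by decide
  have hl := fun a => (h.smooth_eigenvalue a).continuousOn
  have hd := fun a b => (h.smooth_frameDeriv a b).continuousOn
  have hinv : ∀ a b, a ≠ b → ContinuousOn (fun u => 1 / (lam a u - lam b u)) U := fun a b hab =>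
    continuousOn_const.div ((hl a).sub (hl b)) fun u hu => h.sub_ne_zero hu hab
  unfold normalizerLogDeriv
  by_cases hij : i = j
  · simp only [if_pos hij]
    exact (h.contDiffOn_christoffel i i i).continuousOn.sub
      (((continuousOn_const.mul (hd _ _)).mul ((hinv _ _ (e1 i)).add (hinv _ _ (e2 i)))).add
        ((continuousOn_const.mul (hd _ _)).mul ((hinv _ _ (e3 i)).add (hinv _ _ (e2 i).symm))))
  · simp only [if_neg hij]
    exact (h.contDiffOn_structCoeff j i j).continuousOn

theorem IsTFrame.frameDeriv_normalizer (h : IsTFrame U lam Ω X) (hρ : IsNormalization U ρ)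
    {c : Fin 3 → Fin 3 → Fin 3 → ℝ}
    (hC : IsConstTFrame U lam (rescaleForm ρ Ω) (rescaleField ρ X) c) (hu : u ∈ U) (i j : Fin 3) :
    frameDeriv X i (ρ j) u = ρ j u * normalizerLogDeriv lam Ω X i j u := by
  have hi := (hρ i).2 u hu
  have hj := (hρ j).2 u hu
  by_cases hij : i = j
  · subst hij
    have e1 : ∀ i : Fin 3, i ≠ i + 1 := by decide
    have e2 : ∀ i : Fin 3, i + 1 ≠ i + 2 := by decide
    have e3 : ∀ i : Fin 3, i ≠ i + 2 := by decide
    have h1 := hC.christoffel_diag (e1 i) (e2 i) (e3 i) hu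
    rw [h.christoffel_rescale hρ hu, if_pos rfl, frameDeriv_rescaleField,
      frameDeriv_rescaleField] at h1
    rw [normalizerLogDeriv, if_pos rfl]
    generalize 1 / (lam i u - lam (i + 1) u) + 1 / (lam (i + 1) u - lam (i + 2) u) = P at *
    generalize 1 / (lam i u - lam (i + 2) u) + 1 / (lam (i + 2) u - lam (i + 1) u) = Q at *
    field_simp at h1
    linear_combination -h1
  · have h1 := hC.structCoeff_eq_zero hij hu
    rw [structCoeff, h.christoffel_rescale hρ hu, h.christoffel_rescale hρ hu, if_pos rfl,
      if_neg (Ne.symm hij)] at h1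
    rw [normalizerLogDeriv, if_neg hij, structCoeff]
    field_simp at h1
    linear_combination -h1

theorem IsDualFrame.reindex (h : IsDualFrame U Ω X) (σ : Equiv.Perm (Fin 3)) :
    IsDualFrame U (fun i => Ω (σ i)) fun i => X (σ i) where
  isOpen := h.isOpen
  smooth_form i := h.smooth_form (σ i)
  smooth_field i := h.smooth_field (σ i)
  dual u hu i j := by simp [h.dual u hu]

end Rescale

/-! ### Nonvanishing of the structure coefficients -/

section Nonvanishing

variable {U V : Set (Fin 3 → ℝ)} {f : (Fin 3 → ℝ) → (Fin 3 → ℝ)}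
  {lam : Fin 3 → (Fin 3 → ℝ) → ℝ} {Ω : Fin 3 → (Fin 3 → ℝ) → ((Fin 3 → ℝ) →L[ℝ] ℝ)}
  {X : Fin 3 → (Fin 3 → ℝ) → (Fin 3 → ℝ)} {u : Fin 3 → ℝ}

/-- The one-form `B k` in the equations `dc = c B k` for `c = c^k_{k+1,k+2}`. -/
noncomputable def structCoeffLogDeriv (lam : Fin 3 → (Fin 3 → ℝ) → ℝ)
    (Ω : Fin 3 → (Fin 3 → ℝ) → ((Fin 3 → ℝ) →L[ℝ] ℝ))
    (X : Fin 3 → (Fin 3 → ℝ) → (Fin 3 → ℝ)) (k : Fin 3) (u : Fin 3 → ℝ) : (Fin 3 → ℝ) →L[ℝ] ℝ :=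
  ∑ l, (normalizerLogDeriv lam Ω X l (k + 1) u + normalizerLogDeriv lam Ω X l (k + 2) u -
    normalizerLogDeriv lam Ω X l k u) • Ω l u

theorem IsTFrame.continuousOn_structCoeffLogDeriv (h : IsTFrame U lam Ω X) (k : Fin 3) :
    ContinuousOn (structCoeffLogDeriv lam Ω X k) U :=
  continuousOn_finsetSum _ fun l _ =>
    (((h.continuousOn_normalizerLogDeriv l _).add (h.continuousOn_normalizerLogDeriv l _)).sub
      (h.continuousOn_normalizerLogDeriv l _)).smul (h.smooth_form l).continuousOn

/-- Near a point where the three structure coefficients are nonzero, the equations `dc = c B`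
follow from the vanishing of the trace part in a normalized coframe. -/
theorem IsTFrame.fderiv_structCoeff_of_ne_zero (h : IsTFrame U lam Ω X)
    (hT : IsTSystem U f lam) (hΩ : IsEigenforms U f lam Ω) (hu : u ∈ U)
    (hne : ∀ k, structCoeff Ω X k (k + 1) (k + 2) u ≠ 0) (k : Fin 3) :
    fderiv ℝ (structCoeff Ω X k (k + 1) (k + 2)) u =
      structCoeff Ω X k (k + 1) (k + 2) u • structCoeffLogDeriv lam Ω X k u := by
  obtain ⟨s, hs, hpos⟩ : ∃ s : Fin 3 → ℝ, (∀ k, s k * s k = 1) ∧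
      ∀ k, 0 < s k * structCoeff Ω X k (k + 1) (k + 2) u := by
    have : ∀ k, ∃ s : ℝ, s * s = 1 ∧ 0 < s * structCoeff Ω X k (k + 1) (k + 2) u := by
      intro k
      rcases (hne k).lt_or_gt with h1 | h1
      · exact ⟨-1, by norm_num, by linarith⟩
      · exact ⟨1, by norm_num, by linarith⟩
    choose s hs using this
    exact ⟨s, fun k => (hs k).1, fun k => (hs k).2⟩
  set V := {x ∈ U | ∀ k, 0 < s k * structCoeff Ω X k (k + 1) (k + 2) x} with hV
  have hVU : V ⊆ U := fun x hx => hx.1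
  have huV : u ∈ V := ⟨hu, hpos⟩
  have hVo : IsOpen V := by
    have : V = ⋂ k, {x ∈ U | 0 < s k * structCoeff Ω X k (k + 1) (k + 2) x} := by
      ext x
      simp only [hV, Set.mem_ofPred_eq, Set.mem_iInter]
      exact ⟨fun hx k => ⟨hx.1, hx.2 k⟩, fun hx => ⟨(hx 0).1, fun k => (hx k).2⟩⟩
    rw [this]
    refine isOpen_iInter_of_finite fun k => ?_
    exact ((continuousOn_const.mul (h.contDiffOn_structCoeff _ _ _).continuousOn)
      ).isOpen_inter_preimage h.isOpen isOpen_Ioi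
  have hX : IsDualFrame V Ω X := h.toIsDualFrame.mono hVo hVU
  have hTV := hT.mono hVU
  have hΩV := hΩ.mono hVU
  obtain ⟨ρ, hρ, hCρ, hnorm⟩ := hX.exists_normalization hs (mul_one 1) fun x hx => hx.2
  have hF := hX.isTFrame hTV hΩV
  have hΩ' : IsEigenforms V f lam (rescaleForm ρ Ω) := hΩV.renormalize (Equiv.refl _) hρ
  have hC : IsConstTFrame V lam (rescaleForm ρ Ω) (rescaleField ρ X)
      (cyclicCoeff fun k => -(s k * 1)) := by
    refine ((hX.rescale hρ).isTFrame hTV hΩ').isConstTFrame (fun k h0 => ?_) fun x hx k => ?_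
    · have := hs k
      rw [mul_one, neg_eq_zero] at h0
      simp [h0] at this
    · rw [hnorm x hx, neg_neg]
  have hρd : ∀ j, HasFrameDeriv X (ρ j) (fun i => ρ j u * normalizerLogDeriv lam Ω X i j u) u :=
    fun j => ⟨(hρ j).1.differentiableAt_of_isOpen hVo huV,
      fun i => hF.frameDeriv_normalizer hρ hC huV i j⟩
  have hk0 := (hρ k).2 u huV
  rw [hX.fderiv_eq_sum huV, structCoeffLogDeriv, Finset.smul_sum]
  refine Finset.sum_congr rfl fun l _ => ?_
  rw [((HasFrameDeriv.const (s k * 1)).mul (((hρd (k + 1)).mul (hρd (k + 2))).div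
    (hρd k) hk0)).eq_of_eqOn hVo huV (fun x hx => hCρ x hx k) l, hCρ u huV k, smul_smul]
  congr 1
  field_simp
  ring

/-- On a nonempty open set, `c^k_{k+1,k+2}` cannot vanish identically. -/
theorem IsTFrame.exists_structCoeff_ne_zero (h : IsTFrame U lam Ω X) (hT : IsTSystem U f lam)
    (hΩ : IsEigenforms U f lam Ω) (hR : HasNoRiemannInvariants U f lam) (hVo : IsOpen V)
    (hVU : V ⊆ U) (hV : V.Nonempty) (k : Fin 3) :
    ∃ u ∈ V, structCoeff Ω X k (k + 1) (k + 2) u ≠ 0 := by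
  by_contra! hzero
  have e1 : ∀ k : Fin 3, k + 1 ≠ k + 2 := by decide
  have e2 : ∀ k : Fin 3, k + 2 ≠ k := by decide
  have e3 : ∀ k : Fin 3, k + 1 ≠ k := by decide
  have hF := (h.toIsDualFrame.mono hVo hVU).isTFrame (hT.mono hVU) (hΩ.mono hVU)
  obtain ⟨W, hWV, hWo, hW, R, hRW⟩ :=
    hF.exists_riemannInvariant (hΩ.mono hVU) hV (e1 k) (e2 k) (e3 k) hzero
  exact hR k W (hWV.trans hVU) hWo hW ⟨R, hRW⟩

/-- Without Riemann invariants the structure coefficients have no zeros at all: the equations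
`dc = c B` extend by density to the whole of `U`, so that zeros would propagate. -/
theorem IsTFrame.structCoeff_ne_zero (h : IsTFrame U lam Ω X) (hT : IsTSystem U f lam)
    (hΩ : IsEigenforms U f lam Ω) (hR : HasNoRiemannInvariants U f lam) (hconn : IsConnected U)
    (hu : u ∈ U) (k : Fin 3) : structCoeff Ω X k (k + 1) (k + 2) u ≠ 0 := by
  set C : Fin 3 → (Fin 3 → ℝ) → ℝ := fun k => structCoeff Ω X k (k + 1) (k + 2) with hC
  have hCs : ∀ k, ContDiffOn ℝ ∞ (C k) U := fun k => h.contDiffOn_structCoeff _ _ _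
  set G := {x ∈ U | ∀ k, C k x ≠ 0} with hG
  have hdense : U ⊆ closure G := by
    intro x hx
    rw [mem_closure_iff]
    intro o ho hxo
    have hstep : ∀ V : Set (Fin 3 → ℝ), IsOpen V → V ⊆ U → V.Nonempty → ∀ k,
        IsOpen {y ∈ V | C k y ≠ 0} ∧ {y ∈ V | C k y ≠ 0}.Nonempty := by
      intro V hVo hVU hV k
      obtain ⟨y, hy, hy0⟩ := h.exists_structCoeff_ne_zero hT hΩ hR hVo hVU hV k
      exact ⟨((hCs k).continuousOn.mono hVU).isOpen_inter_preimage hVo isOpen_ne, y, hy, hy0⟩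
    obtain ⟨o0, n0⟩ := hstep (o ∩ U) (ho.inter h.isOpen) Set.inter_subset_right ⟨x, hxo, hx⟩ 0
    obtain ⟨o1, n1⟩ := hstep _ o0 (fun y hy => hy.1.2) n0 1
    obtain ⟨-, y, hy⟩ := hstep _ o1 (fun y hy => hy.1.1.2) n1 2
    refine ⟨y, hy.1.1.1.1, hy.1.1.1.2, fun k => ?_⟩
    fin_cases k
    exacts [hy.1.1.2, hy.1.2, hy.2]
  have hfderiv : Set.EqOn (fderiv ℝ (C k))
      (fun x => C k x • structCoeffLogDeriv lam Ω X k x) U := by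
    refine Set.EqOn.of_subset_closure (s := G) (fun x hx => ?_)
      (contDiffOn_fderiv_of_isOpen (hCs k) h.isOpen).continuousOn
      ((hCs k).continuousOn.smul (h.continuousOn_structCoeffLogDeriv k)) (fun x hx => hx.1) hdense
    exact h.fderiv_structCoeff_of_ne_zero hT hΩ hx.1 hx.2 k
  intro h0
  obtain ⟨x, hx, hne⟩ :=
    h.exists_structCoeff_ne_zero hT hΩ hR h.isOpen subset_rfl hconn.nonempty k
  refine hne (eq_zero_of_fderiv_eq_smul h.isOpen hconn.isPreconnected (g := C k)
    (B := structCoeffLogDeriv lam Ω X k) (fun y hy => ?_)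
    (h.continuousOn_structCoeffLogDeriv k) hu h0 x hx)
  have := ((hCs k).differentiableAt_of_isOpen h.isOpen hy).hasFDerivAt
  rwa [hfderiv hy] at this

end Nonvanishing

/-! ### The normalized coframe -/

theorem IsPreconnected.exists_sign {E : Type*} [TopologicalSpace E] {U : Set E}
    (hU : IsPreconnected U) {g : E → ℝ} (hg : ContinuousOn g U) (h0 : ∀ u ∈ U, g u ≠ 0) :
    ∃ s : ℝ, (s = 1 ∨ s = -1) ∧ ∀ u ∈ U, 0 < s * g u := by
  by_cases hpos : ∀ u ∈ U, 0 < g u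
  · exact ⟨1, Or.inl rfl, fun u hu => by rw [one_mul]; exact hpos u hu⟩
  · push Not at hpos
    obtain ⟨x, hx, hx0⟩ := hpos
    refine ⟨-1, Or.inr rfl, fun u hu => ?_⟩
    by_contra hneg
    obtain ⟨z, hz, hz0⟩ := hU.intermediate_value hx hu hg ⟨hx0, by linarith⟩
    exact h0 z hz hz0

/-- The structure coefficients have constant signs, and are normalized to signs. A common sign `t`
is still free, and two of the three signs agree. -/
theorem exists_structureEquations {U : Set (Fin 3 → ℝ)} (hU : IsOpen U) (hconn : IsConnected U)
    {f : (Fin 3 → ℝ) → (Fin 3 → ℝ)} {lam : Fin 3 → (Fin 3 → ℝ) → ℝ}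
    (hT : IsTSystem U f lam) (hR : HasNoRiemannInvariants U f lam)
    {om : Fin 3 → (Fin 3 → ℝ) → ((Fin 3 → ℝ) →L[ℝ] ℝ)} (hom : IsEigenforms U f lam om) :
    ∃ (σ : Equiv.Perm (Fin 3)) (ε : ℝ) (ρ : Fin 3 → (Fin 3 → ℝ) → ℝ),
      (ε = 1 ∨ ε = -1) ∧ IsNormalization U ρ ∧ StructureEquations U ε (renormalize om σ ρ) := by
  obtain ⟨X, hX⟩ := hom.exists_dualFrame hU hT
  have hF := hX.isTFrame hT hom
  choose s hs1 hs using fun k => hconn.isPreconnected.exists_sign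
    (hX.contDiffOn_structCoeff k (k + 1) (k + 2)).continuousOn
    fun u hu => hF.structCoeff_ne_zero hT hom hR hconn hu k
  -- two of the three signs agree; a cyclic renumbering makes them the first and the third
  obtain ⟨n, hn⟩ : ∃ n : Fin 3, s n = s (2 + n) := by
    by_cases h02 : s 0 = s 2
    · exact ⟨0, h02⟩
    · by_cases h10 : s 1 = s 0
      · exact ⟨1, h10⟩
      · refine ⟨2, show s 2 = s 1 from ?_⟩
        rcases hs1 0 with h0 | h0 <;> rcases hs1 1 with h1 | h1 <;> rcases hs1 2 with h2 | h2 <;>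
          simp_all
  set σ : Equiv.Perm (Fin 3) := Equiv.addRight n with hσ
  have hσk : ∀ k, σ k = k + n := fun k => rfl
  have hXσ := hX.reindex σ
  have hsq : ∀ k, s k * s k = 1 := fun k => by rcases hs1 k with h | h <;> norm_num [h]
  obtain ⟨ρ, hρ, -, hnorm⟩ := hXσ.exists_normalization (s := fun k => s (σ k)) (t := -s n)
    (fun k => hsq _) (by linarith [hsq n]) fun u hu k => by
      have h1 : σ (k + 1) = σ k + 1 := by simp only [hσk, add_right_comm]
      have h2 : σ (k + 2) = σ k + 2 := by simp only [hσk, add_right_comm]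
      have := hs (σ k) u hu
      rw [← h1, ← h2] at this
      exact this
  have hΩ : IsEigenforms U f (fun i => lam (σ i)) (renormalize om σ ρ) := hom.renormalize σ hρ
  have hY : IsDualFrame U (renormalize om σ ρ) (rescaleField ρ fun i => X (σ i)) :=
    hXσ.rescale hρ
  have hC : IsConstTFrame U (fun i => lam (σ i)) (renormalize om σ ρ)
      (rescaleField ρ fun i => X (σ i)) (cyclicCoeff fun k => s (σ k) * s n) := by
    refine (hY.isTFrame (hT.reindex σ) hΩ).isConstTFrame (fun k h0 => ?_) fun u hu k => ?_
    · rcases hs1 (σ k) with h1 | h1 <;> rcases hs1 n with h2 | h2 <;> norm_num [h1, h2] at h0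
    · rw [← mul_neg]
      exact hnorm u hu k
  refine ⟨σ, s (σ 1) * s n, ρ, ?_, hρ, fun u hu v w => ?_⟩
  · rcases hs1 (σ 1) with h1 | h1 <;> rcases hs1 n with h2 | h2 <;> norm_num [h1, h2]
  · have hz : ∀ i j, i ≠ j → structCoeff (renormalize om σ ρ)
        (rescaleField ρ fun i => X (σ i)) j i j u = 0 := fun i j hij =>
      hC.structCoeff_eq_zero hij hu
    have hz' : ∀ i j, i ≠ j → structCoeff (renormalize om σ ρ)
        (rescaleField ρ fun i => X (σ i)) j j i u = 0 := fun i j hij => by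
      rw [IsTFrame.structCoeff_antisymm, hz i j hij, neg_zero]
    have h0 : s (σ 0) * s n = 1 := by rw [hσk, zero_add, hsq]
    have h2 : s (σ 2) * s n = 1 := by rw [hσk, ← hn, hsq]
    refine ⟨?_, ?_, ?_⟩
    · rw [hY.dForm_eq_structCoeff hu, hz' _ _ (by decide), hz _ _ (by decide),
        hC.structCoeff_eq u hu 1 2 0 (by decide) (by decide) (by decide)]
      simp [cyclicCoeff, h0]
    · rw [hY.dForm_eq_structCoeff hu, hz _ _ (by decide), hz' _ _ (by decide),
        hC.structCoeff_eq u hu 2 0 1 (by decide) (by decide) (by decide)]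
      simp [cyclicCoeff]
    · rw [hY.dForm_eq_structCoeff hu, hz _ _ (by decide), hz' _ _ (by decide),
        hC.structCoeff_eq u hu 0 1 2 (by decide) (by decide) (by decide)]
      simp [cyclicCoeff, h2]

theorem theorem9 (U : Set (Fin 3 → ℝ)) (hU : IsOpen U) (hconn : IsConnected U)
    (f : (Fin 3 → ℝ) → (Fin 3 → ℝ)) (lam : Fin 3 → (Fin 3 → ℝ) → ℝ)
    (hT : IsTSystem U f lam) (hR : HasNoRiemannInvariants U f lam)
    (om : Fin 3 → (Fin 3 → ℝ) → ((Fin 3 → ℝ) →L[ℝ] ℝ)) (hom : IsEigenforms U f lam om) :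
    (∃ (σ : Equiv.Perm (Fin 3)) (ε : ℝ) (ρ : Fin 3 → (Fin 3 → ℝ) → ℝ),
      (ε = 1 ∨ ε = -1) ∧ IsNormalization U ρ ∧ StructureEquations U ε (renormalize om σ ρ)) ∧
    (∀ (σ : Equiv.Perm (Fin 3)) (ε : ℝ) (ρ : Fin 3 → (Fin 3 → ℝ) → ℝ)
        (a b p q r s : (Fin 3 → ℝ) → ℝ),
      (ε = 1 ∨ ε = -1) → IsNormalization U ρ →
      StructureEquationsWith U ε a b p q r s (renormalize om σ ρ) →
      (∀ u ∈ U, a u = 0 ∧ b u = 0 ∧ p u = 0 ∧ q u = 0 ∧ r u = 0 ∧ s u = 0) ∧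
      ∃ (l : Fin 3 → Fin 3 → (Fin 3 → ℝ) → ℝ) (m : Fin 3 → Fin 3 → Fin 3 → (Fin 3 → ℝ) → ℝ),
        (∀ i, IsCoframeDeriv U (renormalize om σ ρ) (lam (σ i)) (l i)) ∧
        (∀ i j, IsCoframeDeriv U (renormalize om σ ρ) (l i j) (m i j)) ∧
        ∀ u ∈ U, SecondDerivativeFormulas ![1, ε, 1] (fun i => lam (σ i) u)
          (fun i j => l i j u) (fun i j k => m i j k u)) :=
  ⟨exists_structureEquations hU hconn hT hR hom, fun σ _ _ _ _ _ _ _ _ hε hρ hS =>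
    hS.rigidity hU (hT.reindex σ) (hom.renormalize σ hρ) hε⟩
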